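/- Let $n\ge 1$ agents form a connected undirected graph with a doubly stochastic weight matrix $A=[a_{ij}]$ such that, for some constant $c>0$, $a_{ij}>c$ if $j=i$ or $j$ is adjacent to $i$, and $a_{ij}=0$ otherwise. Agent $i$ has the cost $f_i(x)=\mathbb{E}_{\xi_i\sim\mathcal D_i}[\ell_i(x,\xi_i)]$, $x\in\mathbb{R}^d$, which is differentiable with Lipschitz gradient and satisfies $\langle\nabla f_i(x)-\nabla f_i(y),x-y\rangle\ge\mu\|x-y\|^2$ for all $x,y$, where $\mu>0$. It can sample gradients $g_i(x,\xi_i)$, $\xi_i\sim\mathcal D_i$, with $\mathbb{E}[g_i(x,\xi_i)]=\nabla f_i(x)$ and $\mathbb{E}[\|g_i(x,\xi_i)-\nabla f_i(x)\|^2]\le\sigma_g^2$ for all $x$. From arbitrary initial values $x_{i,0}\in\mathbb{R}^d$ the agents iterate $$x_{i,k+1}=(1-\beta_k)x_{i,k}+\beta_k\sum_{j}a_{ij}(x_{j,k}+n_{j,k})-\frac{\alpha_k}{\gamma_k}\sum_{l=1}^{\gamma_k}g_i(x_{i,k},\xi_{i}^{k,l}),$$ where $\xi_i^{k,l}\sim\mathcal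 D_i$, samples drawn under different $(k,l)$ are independent, the noises $n_{i,k}\in\mathbb{R}^d$ are independent over all $i$ and $k$ and independent of the samples, and each coordinate of $n_{i,k}$ is zero-mean Laplace with variance $2\sigma_k^2$. Let $\alpha_k=\frac{a_1}{(k+a_2)^\alpha}$, $\beta_k=\frac{a_1}{(k+a_2)^\beta}$, $\gamma_k=\lceil a_3(k+a_2)^\gamma\rceil$ and $\sigma_k=O((k+a_2)^\eta)$, with $a_1,a_2,a_3>0$, $0<\beta<\alpha\le1$, $\gamma\ge0$ and $0\le\eta\le\frac{3\beta-2}{2}$. Then $f=\sum_{i=1}^n f_i$ has a unique minimizer $x^*$, all $\mathbb{E}[\|x_{i,k}-x^*\|^2]$ are finite, and, for every agent $i$, as $k\to\infty$: - if $\alpha<1$, then $\mathbb{E}[\|x_{i,k}-x^*\|^2]=O\Big(\dfrac{1}{(k+a_2)^{\min\{3\beta-2\alpha-2\eta,\ \alpha-\beta\}}}\Big)$; - if $\alpha=1$, then $\mathbb{E}[\|x_{i,k}-x^*\|^2]=O\Big(\dfrac{\ln k}{(k+a_2)^{\min\{a_1\mu-1+\beta,\ 3\beta-2\eta-2,\ 1-\beta\}}}\Big)$.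 -/

import Mathlib

open MeasureTheory ProbabilityTheory Filter Asymptotics
open scoped NNReal Gradient

namespace DPOpt

/-- The zero-mean Laplace distribution on the real line with scale `b`, i.e. with density
`exp (-|x| / b) / (2 b)` and variance `2 b ^ 2`; for `b = 0` it is the point mass at `0`. -/
noncomputable def laplaceMeasure (b : ℝ≥0) : Measure ℝ :=
  if b = 0 then Measure.dirac 0
  else volume.withDensity (fun x => ENNReal.ofReal (Real.exp (-|x| / b) / (2 * b)))

/-- The local cost `f i x = E[ℓ i (x, ξ)]`, where `ξ` has law `D i`. -/
noncomputable def localCost {V : Type*} {d : ℕ} {Ξ : V → Type*} [∀ i, MeasurableSpace (Ξ i)]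
    (D : ∀ i, Measure (Ξ i)) (ℓ : ∀ i, EuclideanSpace ℝ (Fin d) → Ξ i → ℝ)
    (i : V) (x : EuclideanSpace ℝ (Fin d)) : ℝ :=
  ∫ s, ℓ i x s ∂(D i)

/-- Every local cost is differentiable with Lipschitz gradient and is `μ`-strongly convex. -/
structure RegularCosts {V : Type*} {d : ℕ} (f : V → EuclideanSpace ℝ (Fin d) → ℝ) (μ : ℝ) :
    Prop where
  differentiable : ∀ i, Differentiable ℝ (f i)
  lipschitz : ∀ i, ∃ L : ℝ, 0 < L ∧ ∀ x y, ‖∇ (f i) x - ∇ (f i) y‖ ≤ L * ‖x - y‖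
  mu_pos : 0 < μ
  strongly_convex : ∀ i x y, μ * ‖x - y‖ ^ 2 ≤ inner ℝ (∇ (f i) x - ∇ (f i) y) (x - y)

/-- `g i x s` is the gradient that agent `i` samples at the point `x` with the data `s`. Sampled
gradients are square integrable and unbiased, with variance at most `σg ^ 2`. -/
structure GradientOracle {V : Type*} {d : ℕ} {Ξ : V → Type*} [∀ i, MeasurableSpace (Ξ i)]
    (D : ∀ i, Measure (Ξ i)) (f : V → EuclideanSpace ℝ (Fin d) → ℝ)
    (g : ∀ i, EuclideanSpace ℝ (Fin d) → Ξ i → EuclideanSpace ℝ (Fin d)) (σg : ℝ) : Prop where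
  measurable : ∀ i, Measurable (Function.uncurry (g i))
  memLp : ∀ i x, MemLp (g i x) 2 (D i)
  unbiased : ∀ i x, ∫ s, g i x s ∂(D i) = ∇ (f i) x
  sigma_pos : 0 < σg
  variance_le : ∀ i x, ∫ s, ‖g i x s - ∇ (f i) x‖ ^ 2 ∂(D i) ≤ σg ^ 2

/-- The undirected graph `G` is connected, and the weight matrix `A` is doubly stochastic, with
entries bounded below by a positive constant on the neighbourhoods (each agent being a neighbour
of itself) and zero elsewhere. -/
structure NetworkWeights {V : Type*} [Fintype V] (G : SimpleGraph V) (A : Matrix V V ℝ) :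
    Prop where
  connected : G.Connected
  lower_bound : ∃ c : ℝ, 0 < c ∧ ∀ i j, (j = i ∨ G.Adj j i) → c < A i j
  zero_off : ∀ i j, ¬ (j = i ∨ G.Adj j i) → A i j = 0
  row_sum : ∀ i, ∑ j, A i j = 1
  col_sum : ∀ j, ∑ i, A i j = 1

/-- The privacy noises `ν i k` are independent over agents and times, and each coordinate of
`ν i k` is zero-mean Laplace with variance `2 (σ k) ^ 2`. -/
structure PrivacyNoise {V : Type*} {d : ℕ} {Ω : Type*} [MeasurableSpace Ω] (P : Measure Ω)
    (σ : ℕ → ℝ≥0) (ν : V → ℕ → Ω → EuclideanSpace ℝ (Fin d)) : Prop where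
  measurable : ∀ i k, Measurable (ν i k)
  law : ∀ i k c, P.map (fun ω => ν i k ω c) = laplaceMeasure (σ k)
  indep : iIndepFun (fun p : V × ℕ => ν p.1 p.2) P

/-- `ξ i k l` is the `l`-th data sample of agent `i` at time `k`. It has law `D i`, and samples
with different `(k, l)` are independent; nothing is required of samples that different agents
draw under the same `(k, l)`. -/
structure DataSamples {V : Type*} {Ξ : V → Type*} [∀ i, MeasurableSpace (Ξ i)]
    {Ω : Type*} [MeasurableSpace Ω] (P : Measure Ω)
    (D : ∀ i, Measure (Ξ i)) (ξ : ∀ i, ℕ → ℕ → Ω → Ξ i) : Prop where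
  measurable : ∀ i k l, Measurable (ξ i k l)
  law : ∀ i k l, P.map (ξ i k l) = D i
  indep : iIndepFun (fun (p : ℕ × ℕ) ω => fun i => ξ i p.1 p.2 ω) P

/-- The noises, taken together, are independent of the data samples, taken together. -/
def NoiseIndepData {V : Type*} {d : ℕ} {Ξ : V → Type*} [∀ i, MeasurableSpace (Ξ i)]
    {Ω : Type*} [MeasurableSpace Ω] (P : Measure Ω)
    (ν : V → ℕ → Ω → EuclideanSpace ℝ (Fin d)) (ξ : ∀ i, ℕ → ℕ → Ω → Ξ i) : Prop :=
  IndepFun (fun ω => fun p : V × ℕ => ν p.1 p.2 ω)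
    (fun ω => fun i => fun p : ℕ × ℕ => ξ i p.1 p.2 ω) P

/-- The iterates of the algorithm with output perturbation: `iterate … k i` is the (random) state
of agent `i` at time `k`. Every agent mixes its own state with the noisy states it receives, and
then moves along the average of `N k` sampled gradients. The weights `A i j` vanish unless `j` is a
neighbour of `i`, so summing over all agents is summing over neighbours. -/
noncomputable def iterate {V : Type*} [Fintype V] {d : ℕ} {Ξ : V → Type*} {Ω : Type*}
    (A : Matrix V V ℝ) (stepα stepβ : ℕ → ℝ) (N : ℕ → ℕ)
    (g : ∀ i, EuclideanSpace ℝ (Fin d) → Ξ i → EuclideanSpace ℝ (Fin d))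
    (x₀ : V → EuclideanSpace ℝ (Fin d))
    (ν : V → ℕ → Ω → EuclideanSpace ℝ (Fin d)) (ξ : ∀ i, ℕ → ℕ → Ω → Ξ i) :
    ℕ → V → Ω → EuclideanSpace ℝ (Fin d)
  | 0, i, _ => x₀ i
  | k + 1, i, ω =>
      (1 - stepβ k) • iterate A stepα stepβ N g x₀ ν ξ k i ω
        + stepβ k • ∑ j, A i j • (iterate A stepα stepβ N g x₀ ν ξ k j ω + ν j k ω)
        - stepα k • ((N k : ℝ)⁻¹ • ∑ l ∈ Finset.range (N k),
            g i (iterate A stepα stepβ N g x₀ ν ξ k i ω) (ξ i k l ω))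

end DPOpt

/-!
Let `U k` be the total mean square error `∑ i, E ‖x k i - xs‖ ^ 2`, where `xs` is the minimizer of
the total cost. The whole proof consists of a scalar recursion for `U`, so consensus error and
optimality error are never treated separately.

*Minimizer.* The total gradient is strongly monotone and Lipschitz, hence `x ↦ x - τ • ∇ f x` is a
contraction for small `τ` and `∇ f` has a zero, at which `f` is strictly minimal
(`RegularCosts.exists_minimizer`).

*Deterministic part.* Mixing with a doubly stochastic matrix does not increase the sum of the
squared errors, and even decreases it by a multiple of `β k` times the Dirichlet form of the weights
(`disagreement`). Strong convexity of the local costs gives a decrease by `2 * μ * α k * U k`. The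
local gradients `∇ (f i) xs` need not vanish, but they sum to zero, so by the discrete Poincaré
inequality on the connected graph their pairing with the errors is controlled by the Dirichlet form
(`NetworkWeights.exists_sum_inner_sq_le`). By Young's inequality the loss is absorbed by the mixing
gain at the price of a term of order `α k ^ 2 / β k` (`NetworkWeights.sum_norm_step_sq_le`).

*Random part.* The state at time `k` is measurable with respect to the randomness of the earlier
times, of which the noises and the samples at time `k` are independent. Hence both perturbations are
orthogonal in `L²` to the noiseless step (`uncorrelatedNoise_of_indepFun`), and they only contribute
second moments of order `β k ^ 2 * σ k ^ 2` and `α k ^ 2` (`sum_integral_norm_sq_succ_le`). Averaging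
over a batch of samples is only used in the form that it does not increase the variance.

*Rate.* Eventually `U (k + 1) ≤ (1 - μ * α k) * U k + C * (k + a₂) ^ (-α - p)` for every
`p ≤ min (α - β) (2 * β - 2 * η - α)`, so that `U k = O((k + a₂) ^ (-p))` by induction; for `α = 1`
this needs `p < a₁ * μ` (`isBigO_of_polynomial_steps`). The exponents to be proved are among these,
since `β < α ≤ 1`.
-/

namespace DPOpt

/-! ### A scalar recursion with polynomially decaying coefficients -/

/-- A Bernoulli inequality: `(t + 1) ^ (-p)` is at least `(1 - p⁺ / t) * t ^ (-p)`. -/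
theorem one_sub_div_mul_rpow_neg_le {t : ℝ} (ht : 0 < t) (p : ℝ) :
    (1 - max p 0 / t) * t ^ (-p) ≤ (t + 1) ^ (-p) := by
  have h1 : t + 1 = (1 + t⁻¹) * t := by field_simp
  have hs : 0 < t⁻¹ := inv_pos.2 ht
  rw [h1, Real.mul_rpow (by positivity) ht.le]
  refine mul_le_mul_of_nonneg_right ?_ (Real.rpow_nonneg ht.le _)
  have hlog0 : 0 ≤ Real.log (1 + t⁻¹) := Real.log_nonneg (by linarith)
  have hlog1 : Real.log (1 + t⁻¹) ≤ t⁻¹ := by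
    have := Real.log_le_sub_one_of_pos (show 0 < 1 + t⁻¹ by linarith)
    linarith
  rw [Real.rpow_def_of_pos (by linarith)]
  have h2 := Real.add_one_le_exp (Real.log (1 + t⁻¹) * -p)
  have h3 : p * Real.log (1 + t⁻¹) ≤ max p 0 * t⁻¹ :=
    (mul_le_mul_of_nonneg_right (le_max_left p 0) hlog0).trans
      (mul_le_mul_of_nonneg_left hlog1 (le_max_right p 0))
  rw [div_eq_mul_inv]
  linarith

/-- With `t = k + a`, a recursion `u (k + 1) ≤ (1 - b t ^ (-α)) u k + C t ^ (-α - p)` forces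
`u k = O(t ^ (-p))`, provided that `t ^ (-p)` itself decays by a relative amount of at most
`b' t ^ (-α)` per step, for some `b' < b`. Then `M t ^ (-p)` is a supersolution for large `M`. -/
theorem isBigO_rpow_neg_of_recursion {u : ℕ → ℝ} (hu : ∀ k, 0 ≤ u k) {a b b' C α p : ℝ}
    (ha : 0 < a) (hα : 0 < α) (hbb' : b' < b)
    (hp : ∀ᶠ k : ℕ in atTop, max p 0 / ((k : ℝ) + a) ≤ b' * ((k : ℝ) + a) ^ (-α))
    (hrec : ∀ᶠ k : ℕ in atTop, u (k + 1) ≤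
      (1 - b * ((k : ℝ) + a) ^ (-α)) * u k + C * ((k : ℝ) + a) ^ (-α - p)) :
    u =O[atTop] fun k : ℕ => ((k : ℝ) + a) ^ (-p) := by
  have ht : ∀ k : ℕ, 0 < (k : ℝ) + a := fun k => by positivity
  have hlim : Tendsto (fun k : ℕ => b * ((k : ℝ) + a) ^ (-α)) atTop (nhds (b * 0)) :=
    ((tendsto_rpow_neg_atTop hα).comp
      (tendsto_atTop_add_const_right _ a tendsto_natCast_atTop_atTop)).const_mul b
  rw [mul_zero] at hlim
  obtain ⟨k₀, hk₀⟩ := eventually_atTop.1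
    (hp.and (hrec.and (hlim.eventually (eventually_le_nhds zero_lt_one))))
  set M : ℝ := max (u k₀ * ((k₀ : ℝ) + a) ^ p) (C / (b - b'))
  have hM : ∀ k ≥ k₀, u k ≤ M * ((k : ℝ) + a) ^ (-p) := by
    intro k hk
    induction k, hk using Nat.le_induction with
    | base =>
      have h := mul_le_mul_of_nonneg_right (le_max_left (u k₀ * ((k₀ : ℝ) + a) ^ p) (C / (b - b')))
        (Real.rpow_nonneg (ht k₀).le (-p))
      rwa [mul_assoc, ← Real.rpow_add (ht k₀), add_neg_cancel, Real.rpow_zero, mul_one] at h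
    | succ k hk ih =>
      obtain ⟨h1, h2, h3⟩ := hk₀ k hk
      have hMC : C ≤ M * (b - b') := (div_le_iff₀ (by linarith)).1 (le_max_right _ _)
      have hM0 : 0 ≤ M := le_max_of_le_left (mul_nonneg (hu _) (Real.rpow_nonneg (ht _).le _))
      have h4 := one_sub_div_mul_rpow_neg_le (ht k) p
      have hx := Real.rpow_nonneg (ht k).le (-α)
      have hy := Real.rpow_nonneg (ht k).le (-p)
      have hxy : ((k : ℝ) + a) ^ (-α - p) = ((k : ℝ) + a) ^ (-α) * ((k : ℝ) + a) ^ (-p) := by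
        rw [← Real.rpow_add (ht k), sub_eq_add_neg]
      rw [hxy] at h2
      have hcast : ((k + 1 : ℕ) : ℝ) + a = (k : ℝ) + a + 1 := by push_cast; ring
      rw [hcast]
      set x := ((k : ℝ) + a) ^ (-α)
      set y := ((k : ℝ) + a) ^ (-p)
      calc u (k + 1) ≤ (1 - b * x) * u k + C * (x * y) := h2
        _ ≤ (1 - b * x) * (M * y) + M * (b - b') * (x * y) := by
            gcongr
        _ = M * ((1 - b' * x) * y) := by ring
        _ ≤ M * ((1 - max p 0 / ((k : ℝ) + a)) * y) := by gcongr
        _ ≤ _ := by gcongr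
  refine IsBigO.of_bound M ?_
  filter_upwards [eventually_ge_atTop k₀] with k hk
  rw [Real.norm_of_nonneg (hu k), Real.norm_of_nonneg (Real.rpow_nonneg (ht k).le _)]
  exact hM k hk

/-! ### Zeros of strongly monotone gradients -/

section Minimizer

variable {F : Type*} [NormedAddCommGroup F] [InnerProductSpace ℝ F]

/-- A strongly monotone Lipschitz map on a Hilbert space has a zero, by Banach's fixed point
theorem. -/
theorem exists_zero_of_strongly_monotone [CompleteSpace F] {T : F → F} {m L : ℝ}
    (hm : 0 < m) (hL : ∀ x y, ‖T x - T y‖ ≤ L * ‖x - y‖)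
    (hmono : ∀ x y, m * ‖x - y‖ ^ 2 ≤ inner ℝ (T x - T y) (x - y)) :
    ∃ x, T x = 0 := by
  -- `x ↦ x - τ • T x` contracts squared distances by `1 - 2 τ m + τ² K²`.
  set K : ℝ := max L m
  have hK : 0 < K := lt_max_of_lt_right hm
  have hmK : m ≤ K := le_max_right _ _
  set τ : ℝ := m / K ^ 2
  have hτ : 0 < τ := by positivity
  set q : ℝ := 1 - m ^ 2 / K ^ 2
  have hq0 : 0 ≤ q := by
    have : m ^ 2 / K ^ 2 ≤ 1 := div_le_one_of_le₀ (by gcongr) (by positivity)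
    simp only [q]; linarith
  have hq1 : q < 1 := by
    have : 0 < m ^ 2 / K ^ 2 := by positivity
    simp only [q]; linarith
  have hc : ContractingWith (Real.toNNReal (Real.sqrt q)) (fun x => x - τ • T x) := by
    refine ⟨?_, LipschitzWith.of_dist_le_mul fun x y => ?_⟩
    · rw [← Real.toNNReal_one]
      exact (Real.toNNReal_lt_toNNReal_iff one_pos).2 ((Real.sqrt_lt' one_pos).2 (by simpa using hq1))
    · rw [dist_eq_norm, dist_eq_norm, Real.coe_toNNReal _ (Real.sqrt_nonneg _)]
      refine abs_le_of_sq_le_sq' ?_ (by positivity) |>.2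
      rw [mul_pow, Real.sq_sqrt hq0,
        show x - τ • T x - (y - τ • T y) = (x - y) - τ • (T x - T y) by
          rw [smul_sub]; abel,
        norm_sub_sq_real, inner_smul_right, real_inner_comm, norm_smul, mul_pow, Real.norm_eq_abs,
        sq_abs]
      have h1 := hmono x y
      have h2 : ‖T x - T y‖ ^ 2 ≤ K ^ 2 * ‖x - y‖ ^ 2 := by
        rw [← mul_pow]
        have : L * ‖x - y‖ ≤ K * ‖x - y‖ :=
          mul_le_mul_of_nonneg_right (le_max_left _ _) (norm_nonneg _)
        gcongr
        exact (hL x y).trans this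
      calc ‖x - y‖ ^ 2 - 2 * (τ * inner ℝ (T x - T y) (x - y)) + τ ^ 2 * ‖T x - T y‖ ^ 2
          ≤ ‖x - y‖ ^ 2 - 2 * (τ * (m * ‖x - y‖ ^ 2)) + τ ^ 2 * (K ^ 2 * ‖x - y‖ ^ 2) := by
            gcongr
        _ = q * ‖x - y‖ ^ 2 := by simp only [τ, q]; field_simp; ring
  have : Nonempty F := ⟨0⟩
  refine ⟨hc.fixedPoint, ?_⟩
  have h := hc.fixedPoint_isFixedPt
  simp only [Function.IsFixedPt, sub_eq_self, smul_eq_zero, hτ.ne', false_or] at h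
  exact h

/-- A critical point of a strongly convex function is its strict minimizer: the function is strictly
increasing along every ray from that point. -/
theorem lt_of_gradient_eq_zero [CompleteSpace F] {f : F → ℝ} {m : ℝ} (hm : 0 < m)
    (hf : Differentiable ℝ f)
    (hmono : ∀ x y, m * ‖x - y‖ ^ 2 ≤ inner ℝ (∇ f x - ∇ f y) (x - y))
    {x : F} (hx : ∇ f x = 0) {y : F} (hy : y ≠ x) : f x < f y := by
  have hd : ∀ t : ℝ, HasDerivAt (fun t : ℝ => f (x + t • (y - x)))
      (inner ℝ (∇ f (x + t • (y - x))) (y - x)) t := by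
    intro t
    have h1 : HasDerivAt (fun t : ℝ => x + t • (y - x)) (y - x) t := by
      simpa using ((hasDerivAt_id t).smul_const (y - x)).const_add x
    have h2 := (hf (x + t • (y - x))).hasGradientAt.hasFDerivAt.comp_hasDerivAt t h1
    exact h2
  have hmo : StrictMonoOn (fun t : ℝ => f (x + t • (y - x))) (Set.Icc 0 1) := by
    refine strictMonoOn_of_deriv_pos (convex_Icc 0 1)
      (fun t _ => (hd t).continuousAt.continuousWithinAt) fun t ht => ?_
    rw [interior_Icc] at ht
    rw [(hd t).deriv]
    have h := hmono (x + t • (y - x)) x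
    rw [hx, sub_zero, add_sub_cancel_left, inner_smul_right] at h
    have hpos : 0 < m * ‖t • (y - x)‖ ^ 2 := by
      have : t • (y - x) ≠ 0 := smul_ne_zero ht.1.ne' (sub_ne_zero.2 hy)
      positivity
    exact pos_of_mul_pos_right (hpos.trans_le h) ht.1.le
  simpa using hmo (by simp) (by simp) zero_lt_one

end Minimizer

/-! ### Mixing over the network -/

section Network

variable {V : Type*} [Fintype V] {F : Type*} [NormedAddCommGroup F]

theorem NetworkWeights.nonneg {G : SimpleGraph V} {A : Matrix V V ℝ} (hA : NetworkWeights G A)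
    (i j : V) : 0 ≤ A i j := by
  obtain ⟨c, hc, h⟩ := hA.lower_bound
  by_cases hij : j = i ∨ G.Adj j i
  · exact hc.le.trans (h i j hij).le
  · exact (hA.zero_off i j hij).ge

/-- The Dirichlet form of the weights `A`: it measures how far the states `z i` are from
agreement. -/
def disagreement (A : Matrix V V ℝ) (z : V → F) : ℝ :=
  ∑ i, ∑ j, A i j * ‖z j - z i‖ ^ 2

theorem NetworkWeights.disagreement_nonneg {G : SimpleGraph V} {A : Matrix V V ℝ}
    (hA : NetworkWeights G A) (z : V → F) : 0 ≤ disagreement A z :=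
  Finset.sum_nonneg fun i _ => Finset.sum_nonneg fun j _ =>
    mul_nonneg (hA.nonneg i j) (sq_nonneg _)

theorem NetworkWeights.norm_sub_sq_le_of_adj {G : SimpleGraph V} {A : Matrix V V ℝ}
    (hA : NetworkWeights G A) {c : ℝ} (hc : 0 < c)
    (h : ∀ i j, (j = i ∨ G.Adj j i) → c < A i j) {i j : V} (hij : G.Adj i j) (z : V → F) :
    ‖z i - z j‖ ^ 2 ≤ c⁻¹ * disagreement A z := by
  rw [inv_mul_eq_div, le_div_iff₀ hc, mul_comm]
  calc c * ‖z i - z j‖ ^ 2 ≤ A j i * ‖z i - z j‖ ^ 2 :=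
        mul_le_mul_of_nonneg_right (h j i (Or.inr hij)).le (sq_nonneg _)
    _ ≤ ∑ l, A j l * ‖z l - z j‖ ^ 2 :=
        Finset.single_le_sum (f := fun l => A j l * ‖z l - z j‖ ^ 2)
          (fun l _ => mul_nonneg (hA.nonneg j l) (sq_nonneg _)) (Finset.mem_univ i)
    _ ≤ disagreement A z :=
        Finset.single_le_sum (f := fun m => ∑ l, A m l * ‖z l - z m‖ ^ 2)
          (fun m _ => Finset.sum_nonneg fun l _ => mul_nonneg (hA.nonneg m l) (sq_nonneg _))
          (Finset.mem_univ j)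

/-- The discrete Poincaré inequality on a connected network: the Dirichlet form controls the
difference of any two states, by chaining the edges of a path. -/
theorem NetworkWeights.exists_norm_sub_sq_le {G : SimpleGraph V} {A : Matrix V V ℝ}
    (hA : NetworkWeights G A) (i j : V) :
    ∃ K : ℝ, 0 ≤ K ∧ ∀ z : V → F, ‖z i - z j‖ ^ 2 ≤ K * disagreement A z := by
  obtain ⟨c, hc, h⟩ := hA.lower_bound
  obtain ⟨w⟩ := hA.connected.preconnected i j
  induction w with
  | nil => exact ⟨0, le_rfl, fun z => by simp⟩
  | @cons u v w huv _ ih =>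
    obtain ⟨K, hK, hz⟩ := ih
    refine ⟨2 * (c⁻¹ + K), by positivity, fun z => ?_⟩
    have h1 := hA.norm_sub_sq_le_of_adj hc h huv z
    have h2 : ‖z u - z w‖ ≤ ‖z u - z v‖ + ‖z v - z w‖ := norm_sub_le_norm_sub_add_norm_sub ..
    have h3 : ‖z u - z w‖ ^ 2 ≤ (‖z u - z v‖ + ‖z v - z w‖) ^ 2 := by gcongr
    have h4 := add_sq_le (a := ‖z u - z v‖) (b := ‖z v - z w‖)
    have h5 := hz z
    linarith

variable [InnerProductSpace ℝ F]

/-- Vectors that sum to zero do not see the consensus component of the states, so their pairing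
with the states is controlled by the disagreement alone. -/
theorem NetworkWeights.exists_sum_inner_sq_le {G : SimpleGraph V} {A : Matrix V V ℝ}
    (hA : NetworkWeights G A) {h : V → F} (hh : ∑ i, h i = 0) :
    ∃ K : ℝ, 0 ≤ K ∧ ∀ z : V → F, (∑ i, inner ℝ (h i) (z i)) ^ 2 ≤ K * disagreement A z := by
  obtain ⟨r⟩ := hA.connected.nonempty
  choose K hK hz using fun i => hA.exists_norm_sub_sq_le (F := F) i r
  refine ⟨Fintype.card V * ∑ i, ‖h i‖ ^ 2 * K i,
    mul_nonneg (Nat.cast_nonneg _) (Finset.sum_nonneg fun i _ => mul_nonneg (sq_nonneg _) (hK i)),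
    fun z => ?_⟩
  have h1 : ∑ i, inner ℝ (h i) (z i) = ∑ i, inner ℝ (h i) (z i - z r) := by
    simp [inner_sub_right, ← sum_inner, hh]
  rw [h1, mul_assoc, Finset.sum_mul]
  refine sq_sum_le_card_mul_sum_sq.trans ?_
  rw [Finset.card_univ]
  refine mul_le_mul_of_nonneg_left (Finset.sum_le_sum fun i _ => ?_) (Nat.cast_nonneg _)
  have h2 : (inner ℝ (h i) (z i - z r)) ^ 2 ≤ (‖h i‖ * ‖z i - z r‖) ^ 2 :=
    sq_le_sq.2 (by
      rw [abs_of_nonneg (by positivity : 0 ≤ ‖h i‖ * ‖z i - z r‖)]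
      exact abs_real_inner_le_norm _ _)
  rw [mul_pow] at h2
  rw [mul_assoc]
  exact h2.trans (mul_le_mul_of_nonneg_left (hz i z) (sq_nonneg _))

/-- Jensen's inequality for the squared norm. -/
theorem norm_sum_smul_sq_le {ι : Type*} (s : Finset ι) {a : ι → ℝ} (ha : ∀ j ∈ s, 0 ≤ a j)
    (ha1 : ∑ j ∈ s, a j = 1) (v : ι → F) :
    ‖∑ j ∈ s, a j • v j‖ ^ 2 ≤ ∑ j ∈ s, a j * ‖v j‖ ^ 2 := by
  have h : ConvexOn ℝ Set.univ fun v : F => ‖v‖ ^ 2 :=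
    convexOn_univ_norm.pow (fun _ _ => norm_nonneg _) 2
  simpa using h.map_sum_le ha ha1 (fun j _ => Set.mem_univ (v j))

/-- The exact effect of one mixing step on the squared norm of one agent's state `w`. -/
theorem norm_add_smul_sum_sq {a : V → ℝ} (ha1 : ∑ j, a j = 1) (β : ℝ) (z : V → F) (w : F) :
    ‖w + β • ∑ j, a j • (z j - w)‖ ^ 2 =
      (1 - β) * ‖w‖ ^ 2 + β * ∑ j, a j * ‖z j‖ ^ 2 - β * ∑ j, a j * ‖z j - w‖ ^ 2
        + β ^ 2 * ‖∑ j, a j • (z j - w)‖ ^ 2 := by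
  have h1 : 2 * inner ℝ w (∑ j, a j • (z j - w)) =
      ∑ j, a j * ‖z j‖ ^ 2 - ‖w‖ ^ 2 - ∑ j, a j * ‖z j - w‖ ^ 2 := by
    have h2 : ‖w‖ ^ 2 = ∑ j, a j * ‖w‖ ^ 2 := by rw [← Finset.sum_mul, ha1, one_mul]
    rw [h2, inner_sum, Finset.mul_sum, ← Finset.sum_sub_distrib, ← Finset.sum_sub_distrib]
    refine Finset.sum_congr rfl fun j _ => ?_
    rw [inner_smul_right, norm_sub_sq_real, inner_sub_right, real_inner_self_eq_norm_sq,
      real_inner_comm]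
    ring
  rw [norm_add_sq_real, inner_smul_right, norm_smul, mul_pow, Real.norm_eq_abs, sq_abs]
  linear_combination β * h1

/-- One noiseless step of the algorithm contracts the sum of the squared errors `‖z i‖ ^ 2`, up to
an error of order `α ^ 2 / β`. Here `g i` is the gradient of agent `i` at its current state and
`h i` the one at the minimizer. The `h i` do not vanish separately, but their total effect is
controlled by the disagreement, and mixing removes the amount `β / 2 * disagreement A z` of
squared error. -/
theorem NetworkWeights.sum_norm_step_sq_le {G : SimpleGraph V} {A : Matrix V V ℝ}
    (hA : NetworkWeights G A) {z g h : V → F} {μ L K α β : ℝ} (hK : 0 ≤ K)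
    (hα : 0 ≤ α) (hβ : 0 < β) (hβ4 : β ≤ 1 / 4)
    (hL : ∀ i, ‖g i - h i‖ ≤ L * ‖z i‖)
    (hmono : ∀ i, μ * ‖z i‖ ^ 2 ≤ inner ℝ (g i - h i) (z i))
    (hh : (∑ i, inner ℝ (h i) (z i)) ^ 2 ≤ K * disagreement A z) :
    ∑ i, ‖z i + β • (∑ j, A i j • (z j - z i)) - α • g i‖ ^ 2 ≤
      (1 - 2 * μ * α + 4 * L ^ 2 * α ^ 2) * ∑ i, ‖z i‖ ^ 2
        + (4 * (∑ i, ‖h i‖ ^ 2) * α ^ 2 + 2 * K * (α ^ 2 / β)) := by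
  have hstep : ∀ i, ‖z i + β • (∑ j, A i j • (z j - z i)) - α • g i‖ ^ 2 ≤
      (1 - β) * ‖z i‖ ^ 2 + β * (∑ j, A i j * ‖z j‖ ^ 2)
        - β / 2 * (∑ j, A i j * ‖z j - z i‖ ^ 2)
        - 2 * μ * α * ‖z i‖ ^ 2 - 2 * α * inner ℝ (h i) (z i)
        + 4 * L ^ 2 * α ^ 2 * ‖z i‖ ^ 2 + 4 * α ^ 2 * ‖h i‖ ^ 2 := by
    intro i
    set e := ∑ j, A i j • (z j - z i)
    set D := ∑ j, A i j * ‖z j - z i‖ ^ 2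
    have hD : 0 ≤ D := Finset.sum_nonneg fun j _ => mul_nonneg (hA.nonneg i j) (sq_nonneg _)
    have he : ‖e‖ ^ 2 ≤ D :=
      norm_sum_smul_sq_le _ (fun j _ => hA.nonneg i j) (hA.row_sum i) _
    have hmix := norm_add_smul_sum_sq (hA.row_sum i) β z (z i)
    have hg : ‖g i‖ ^ 2 ≤ 2 * (L ^ 2 * ‖z i‖ ^ 2 + ‖h i‖ ^ 2) := by
      have h1 : ‖g i‖ ≤ L * ‖z i‖ + ‖h i‖ := by
        have h2 := norm_add_le (g i - h i) (h i)
        rw [sub_add_cancel] at h2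
        linarith [hL i]
      have h3 : ‖g i‖ ^ 2 ≤ (L * ‖z i‖ + ‖h i‖) ^ 2 := by gcongr
      have h4 := add_sq_le (a := L * ‖z i‖) (b := ‖h i‖)
      rw [mul_pow] at h4
      linarith
    have hcross : -2 * (α * β * inner ℝ e (g i)) ≤ β ^ 2 * ‖e‖ ^ 2 + α ^ 2 * ‖g i‖ ^ 2 := by
      have h1 := sq_nonneg ‖β • e + α • g i‖
      rw [norm_add_sq_real, inner_smul_left, inner_smul_right, norm_smul, norm_smul, mul_pow,
        mul_pow, Real.norm_eq_abs, Real.norm_eq_abs, sq_abs, sq_abs] at h1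
      simp only [conj_trivial] at h1
      linarith
    have hm := mul_le_mul_of_nonneg_left (hmono i) hα
    rw [inner_sub_left] at hm
    have hβ2 : 2 * β ^ 2 * ‖e‖ ^ 2 ≤ β / 2 * D := by
      calc 2 * β ^ 2 * ‖e‖ ^ 2 ≤ 2 * β ^ 2 * D := by gcongr
        _ = 2 * β * β * D := by ring
        _ ≤ 2 * β * (1 / 4) * D := by gcongr
        _ = β / 2 * D := by ring
    have hα2 := mul_le_mul_of_nonneg_left hg (by positivity : 0 ≤ 2 * α ^ 2)
    rw [norm_sub_sq_real, hmix, inner_smul_right, inner_add_left, inner_smul_left, norm_smul,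
      mul_pow, Real.norm_eq_abs, sq_abs, real_inner_comm (g i) (z i)]
    simp only [conj_trivial]
    linarith
  have hpair : -2 * α * ∑ i, inner ℝ (h i) (z i) ≤
      β / 2 * disagreement A z + 2 * K * (α ^ 2 / β) := by
    have hD := hA.disagreement_nonneg z
    refine abs_le_of_sq_le_sq ?_ (by positivity) |>.trans' (le_abs_self _)
    have h1 : (2 * K * (α ^ 2 / β)) * (β / 2 * disagreement A z) =
        α ^ 2 * (K * disagreement A z) := by field_simp
    have h2 := mul_le_mul_of_nonneg_left hh (sq_nonneg α)
    nlinarith [sq_nonneg (β / 2 * disagreement A z - 2 * K * (α ^ 2 / β))]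
  have hcol : ∑ i, ∑ j, A i j * ‖z j‖ ^ 2 = ∑ i, ‖z i‖ ^ 2 := by
    rw [Finset.sum_comm]
    exact Finset.sum_congr rfl fun j _ => by rw [← Finset.sum_mul, hA.col_sum, one_mul]
  have hsum := Finset.sum_le_sum fun i (_ : i ∈ Finset.univ) => hstep i
  simp only [Finset.sum_add_distrib, Finset.sum_sub_distrib, ← Finset.mul_sum, hcol] at hsum
  rw [show ∑ i, ∑ j, A i j * ‖z j - z i‖ ^ 2 = disagreement A z from rfl] at hsum
  linarith

end Network

/-! ### Moments of the Laplace noise -/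

section Laplace

theorem integral_laplaceMeasure {b : ℝ≥0} (hb : b ≠ 0) (φ : ℝ → ℝ) :
    ∫ x, φ x ∂(laplaceMeasure b) = ∫ x, Real.exp (-|x| / b) / (2 * b) * φ x := by
  rw [laplaceMeasure, if_neg hb, integral_withDensity_eq_integral_toReal_smul (by fun_prop)
    (ae_of_all _ fun x => ENNReal.ofReal_lt_top)]
  refine integral_congr_ae (ae_of_all _ fun x => ?_)
  simp only [smul_eq_mul]
  rw [ENNReal.toReal_ofReal (by positivity)]

/-- The variance of the Laplace distribution, from the value `Γ(3) = 2`. -/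
theorem integral_sq_laplaceMeasure (b : ℝ≥0) :
    ∫ x, x ^ 2 ∂(laplaceMeasure b) = 2 * (b : ℝ) ^ 2 := by
  by_cases hb : b = 0
  · simp [laplaceMeasure, hb]
  have hb' : 0 < (b : ℝ) := by positivity
  rw [integral_laplaceMeasure hb]
  have h1 := integral_comp_abs
    (f := fun y : ℝ => y ^ (2 : ℝ) * Real.exp (-(b : ℝ)⁻¹ * y ^ (1 : ℝ)))
  rw [integral_rpow_mul_exp_neg_mul_rpow one_pos (by norm_num) (inv_pos.2 hb')] at h1
  have h0 : ∀ x : ℝ, Real.exp (-|x| / b) / (2 * b) * x ^ 2 =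
      (2 * (b : ℝ))⁻¹ * (|x| ^ (2 : ℝ) * Real.exp (-(b : ℝ)⁻¹ * |x| ^ (1 : ℝ))) := by
    intro x
    simp only [Real.rpow_ofNat, Real.rpow_one, sq_abs]
    rw [show -|x| / (b : ℝ) = -(b : ℝ)⁻¹ * |x| by ring]
    ring
  simp_rw [h0]
  rw [integral_const_mul, h1]
  have h2 : ((2 : ℝ) + 1) / 1 = ((2 : ℕ) : ℝ) + 1 := by norm_num
  rw [h2, Real.Gamma_nat_eq_factorial,
    show (-(2 + 1) / 1 : ℝ) = -((3 : ℕ) : ℝ) by norm_num, Real.inv_rpow hb'.le,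
    Real.rpow_neg hb'.le, inv_inv, Real.rpow_natCast]
  simp only [Nat.factorial]
  field_simp
  norm_num

theorem memLp_id_laplaceMeasure (b : ℝ≥0) : MemLp (fun x : ℝ => x) 2 (laplaceMeasure b) := by
  rw [memLp_two_iff_integrable_sq (by fun_prop)]
  by_cases hb : b = 0
  · simpa [laplaceMeasure, hb] using integrable_dirac (by simp)
  · refine Integrable.of_integral_ne_zero ?_
    rw [integral_sq_laplaceMeasure]
    positivity

theorem integral_id_laplaceMeasure (b : ℝ≥0) : ∫ x, x ∂(laplaceMeasure b) = 0 := by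
  by_cases hb : b = 0
  · simp [laplaceMeasure, hb]
  rw [integral_laplaceMeasure hb]
  have h := integral_neg_eq_self (fun x : ℝ => Real.exp (-|x| / b) / (2 * b) * x) volume
  simp only [abs_neg, mul_neg, integral_neg] at h
  linarith

variable {V : Type*} {d : ℕ} {Ω : Type*} [MeasurableSpace Ω] {P : Measure Ω}
  {σ : ℕ → ℝ≥0} {ν : V → ℕ → Ω → EuclideanSpace ℝ (Fin d)}

theorem PrivacyNoise.memLp_coord (hν : PrivacyNoise P σ ν) (i : V) (k : ℕ) (c : Fin d) :
    MemLp (fun ω => ν i k ω c) 2 P := by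
  have hm : AEMeasurable (fun ω => ν i k ω c) P := by
    have := hν.measurable i k
    fun_prop
  refine (memLp_map_measure_iff (g := fun x : ℝ => x) (by fun_prop) hm).1 ?_
  rw [hν.law]
  exact memLp_id_laplaceMeasure _

theorem PrivacyNoise.memLp (hν : PrivacyNoise P σ ν) (i : V) (k : ℕ) : MemLp (ν i k) 2 P :=
  MemLp.of_eval_piLp (hν.memLp_coord i k)

theorem PrivacyNoise.integral_eq_zero [IsProbabilityMeasure P] (hν : PrivacyNoise P σ ν) (i : V)
    (k : ℕ) : ∫ ω, ν i k ω ∂P = 0 := by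
  ext c
  rw [eval_integral_piLp fun c => (hν.memLp_coord i k c).integrable one_le_two]
  have hm : AEMeasurable (fun ω => ν i k ω c) P := by
    have := hν.measurable i k
    fun_prop
  have h := integral_map (f := fun x : ℝ => x) hm (by fun_prop)
  rw [hν.law, integral_id_laplaceMeasure] at h
  simpa using h.symm

theorem PrivacyNoise.integral_norm_sq (hν : PrivacyNoise P σ ν) (i : V) (k : ℕ) :
    ∫ ω, ‖ν i k ω‖ ^ 2 ∂P = d * (2 * (σ k : ℝ) ^ 2) := by
  simp_rw [EuclideanSpace.real_norm_sq_eq]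
  rw [integral_finsetSum _ fun c _ => (hν.memLp_coord i k c).integrable_sq]
  have h : ∀ c, ∫ ω, ν i k ω c ^ 2 ∂P = 2 * (σ k : ℝ) ^ 2 := by
    intro c
    have hm : AEMeasurable (fun ω => ν i k ω c) P := by
      have := hν.measurable i k
      fun_prop
    have h := integral_map (f := fun x : ℝ => x ^ 2) hm (by fun_prop)
    rwa [hν.law, integral_sq_laplaceMeasure, eq_comm] at h
  simp [h]

end Laplace

/-! ### The past and its independence of the present randomness -/

section Independence

/-- If `m₂` is independent of `m₁` and `m₃` together, and these two are independent, then `m₃` is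
independent of `m₁` and `m₂` together. -/
theorem indep_sup_left_of_indep {Ω : Type*} {m₁ m₂ m₃ mΩ : MeasurableSpace Ω} {P : Measure Ω}
    [IsProbabilityMeasure P] (h₁ : m₁ ≤ mΩ) (h₂ : m₂ ≤ mΩ) (h₃ : m₃ ≤ mΩ)
    (h132 : Indep (m₁ ⊔ m₃) m₂ P) (h13 : Indep m₁ m₃ P) : Indep (m₁ ⊔ m₂) m₃ P := by
  set p : Set (Set Ω) := {s | ∃ t, MeasurableSet[m₁] t ∧ ∃ u, MeasurableSet[m₂] u ∧ s = t ∩ u}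
  have hp : IsPiSystem p := by
    rintro _ ⟨t, ht, u, hu, rfl⟩ _ ⟨t', ht', u', hu', rfl⟩ _
    exact ⟨t ∩ t', ht.inter ht', u ∩ u', hu.inter hu', Set.inter_inter_inter_comm ..⟩
  have hgen : m₁ ⊔ m₂ = MeasurableSpace.generateFrom p := by
    refine le_antisymm (sup_le (fun t ht => ?_) (fun u hu => ?_))
      (MeasurableSpace.generateFrom_le ?_)
    · exact MeasurableSpace.measurableSet_generateFrom
        ⟨t, ht, Set.univ, MeasurableSet.univ, (Set.inter_univ t).symm⟩
    · exact MeasurableSpace.measurableSet_generateFrom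
        ⟨Set.univ, MeasurableSet.univ, u, hu, (Set.univ_inter u).symm⟩
    · rintro _ ⟨t, ht, u, hu, rfl⟩
      exact MeasurableSet.inter ((le_sup_left : m₁ ≤ m₁ ⊔ m₂) t ht)
        ((le_sup_right : m₂ ≤ m₁ ⊔ m₂) u hu)
  refine IndepSets.indep (sup_le h₁ h₂) h₃ hp (@MeasurableSpace.isPiSystem_measurableSet Ω m₃) hgen
    (@MeasurableSpace.generateFrom_measurableSet Ω m₃).symm ?_
  rw [IndepSets_iff]
  rintro _ v ⟨t, ht, u, hu, rfl⟩ hv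
  have e1 := (Indep_iff _ _ _).1 h132 (t ∩ v) u
    (MeasurableSet.inter ((le_sup_left : m₁ ≤ m₁ ⊔ m₃) t ht) ((le_sup_right : m₃ ≤ m₁ ⊔ m₃) v hv)) hu
  have e2 := (Indep_iff _ _ _).1 h13 t v ht hv
  have e3 := (Indep_iff _ _ _).1 h132 t u ((le_sup_left : m₁ ≤ m₁ ⊔ m₃) t ht) hu
  rw [Set.inter_right_comm, e1, e2, e3]
  ring

theorem comap_comp_le {Ω α β : Type*} [MeasurableSpace α] [MeasurableSpace β] (Y : Ω → α)
    {φ : α → β} (hφ : Measurable φ) :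
    MeasurableSpace.comap (φ ∘ Y) inferInstance ≤ MeasurableSpace.comap Y inferInstance := by
  rw [← MeasurableSpace.comap_comp]
  exact MeasurableSpace.comap_mono hφ.comap_le

variable {V : Type*} {d : ℕ} {Ξ : V → Type*} [∀ i, MeasurableSpace (Ξ i)] {Ω : Type*}
  {ν : V → ℕ → Ω → EuclideanSpace ℝ (Fin d)} {ξ : ∀ i, ℕ → ℕ → Ω → Ξ i}

/-- The σ-algebra generated by the privacy noises indexed by `S`. -/
abbrev noiseSigma (ν : V → ℕ → Ω → EuclideanSpace ℝ (Fin d)) (S : Set (V × ℕ)) :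
    MeasurableSpace Ω :=
  ⨆ p ∈ S, MeasurableSpace.comap (ν p.1 p.2) inferInstance

/-- The σ-algebra generated by the data samples indexed by `S`, over all agents. -/
abbrev dataSigma (ξ : ∀ i, ℕ → ℕ → Ω → Ξ i) (S : Set (ℕ × ℕ)) : MeasurableSpace Ω :=
  ⨆ p ∈ S, MeasurableSpace.comap (fun ω i => ξ i p.1 p.2 ω) inferInstance

/-- The σ-algebra generated by all the randomness used before time `k`. -/
abbrev pastSigma (ν : V → ℕ → Ω → EuclideanSpace ℝ (Fin d)) (ξ : ∀ i, ℕ → ℕ → Ω → Ξ i) (k : ℕ) :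
    MeasurableSpace Ω :=
  noiseSigma ν {p | p.2 < k} ⊔ dataSigma ξ {p | p.1 < k}

theorem noiseSigma_mono {S T : Set (V × ℕ)} (h : S ⊆ T) : noiseSigma ν S ≤ noiseSigma ν T :=
  biSup_mono h

theorem dataSigma_mono {S T : Set (ℕ × ℕ)} (h : S ⊆ T) : dataSigma ξ S ≤ dataSigma ξ T :=
  biSup_mono h

theorem pastSigma_mono {k l : ℕ} (h : k ≤ l) : pastSigma ν ξ k ≤ pastSigma ν ξ l :=
  sup_le_sup (noiseSigma_mono fun _ hp => lt_of_lt_of_le hp h)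
    (dataSigma_mono fun _ hp => lt_of_lt_of_le hp h)

theorem measurable_noise_pastSigma {i : V} {k l : ℕ} (h : k < l) :
    Measurable[pastSigma ν ξ l] (ν i k) := by
  refine Measurable.mono (comap_measurable _) ?_ le_rfl
  exact le_sup_of_le_left
    (le_iSup₂_of_le (f := fun (p : V × ℕ) (_ : p ∈ {p : V × ℕ | p.2 < l}) =>
      MeasurableSpace.comap (ν p.1 p.2) inferInstance) (i, k) h le_rfl)

theorem measurable_data_pastSigma {i : V} {k l m : ℕ} (h : k < m) :
    Measurable[pastSigma ν ξ m] (ξ i k l) := by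
  have h1 : Measurable[pastSigma ν ξ m] (fun ω i => ξ i k l ω) := by
    refine Measurable.mono (comap_measurable _) ?_ le_rfl
    exact le_sup_of_le_right
      (le_iSup₂_of_le (f := fun (p : ℕ × ℕ) (_ : p ∈ {p : ℕ × ℕ | p.1 < m}) =>
        MeasurableSpace.comap (fun ω i => ξ i p.1 p.2 ω) inferInstance) (k, l) h le_rfl)
  exact (measurable_pi_apply i).comp h1

variable [mΩ : MeasurableSpace Ω] {P : Measure Ω} {D : ∀ i, Measure (Ξ i)} {σ : ℕ → ℝ≥0}

theorem PrivacyNoise.noiseSigma_le (hν : PrivacyNoise P σ ν) (S : Set (V × ℕ)) :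
    noiseSigma ν S ≤ mΩ :=
  iSup₂_le fun p _ => (hν.measurable p.1 p.2).comap_le

theorem DataSamples.dataSigma_le (hξ : DataSamples P D ξ) (S : Set (ℕ × ℕ)) :
    dataSigma ξ S ≤ mΩ :=
  iSup₂_le fun p _ => (measurable_pi_lambda _ fun i => hξ.measurable i p.1 p.2).comap_le

theorem pastSigma_le (hν : PrivacyNoise P σ ν) (hξ : DataSamples P D ξ) (k : ℕ) :
    pastSigma ν ξ k ≤ mΩ :=
  sup_le (hν.noiseSigma_le _) (hξ.dataSigma_le _)

theorem NoiseIndepData.indep_noiseSigma_dataSigma (hνξ : NoiseIndepData P ν ξ)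
    (S : Set (V × ℕ)) (T : Set (ℕ × ℕ)) : Indep (noiseSigma ν S) (dataSigma ξ T) P := by
  refine indep_of_indep_of_le_left (indep_of_indep_of_le_right hνξ ?_) ?_
  · exact iSup₂_le fun p _ => comap_comp_le (fun ω => fun i => fun p : ℕ × ℕ => ξ i p.1 p.2 ω)
      (φ := fun f i => f i p) (measurable_pi_lambda _ fun i =>
        (measurable_pi_apply p).comp (measurable_pi_apply i))
  · exact iSup₂_le fun p _ => comap_comp_le (fun ω => fun p : V × ℕ => ν p.1 p.2 ω)
      (measurable_pi_apply p)

theorem indepFun_noise_of_past [IsProbabilityMeasure P] (hν : PrivacyNoise P σ ν)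
    (hξ : DataSamples P D ξ) (hνξ : NoiseIndepData P ν ξ) {β : Type*} [MeasurableSpace β]
    {k : ℕ} {Y : Ω → β} (hY : Measurable[pastSigma ν ξ k] Y) (j : V) :
    IndepFun Y (ν j k) P := by
  have h1 : Indep (pastSigma ν ξ k) (noiseSigma ν {(j, k)}) P := by
    refine indep_sup_left_of_indep (hν.noiseSigma_le _) (hξ.dataSigma_le _) (hν.noiseSigma_le _)
      ?_ ?_
    · exact indep_of_indep_of_le_left (hνξ.indep_noiseSigma_dataSigma Set.univ _)
        (sup_le (noiseSigma_mono (Set.subset_univ _)) (noiseSigma_mono (Set.subset_univ _)))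
    · exact indep_iSup_of_disjoint
        (m := fun p : V × ℕ => MeasurableSpace.comap (ν p.1 p.2) inferInstance)
        (fun p => (hν.measurable p.1 p.2).comap_le) hν.indep (by simp)
  refine indep_of_indep_of_le_left (indep_of_indep_of_le_right h1 ?_) hY.comap_le
  exact le_iSup₂_of_le (f := fun (p : V × ℕ) (_ : p ∈ ({(j, k)} : Set (V × ℕ))) =>
      MeasurableSpace.comap (ν p.1 p.2) inferInstance) (j, k) rfl le_rfl

theorem indepFun_data_of_past [IsProbabilityMeasure P] (hν : PrivacyNoise P σ ν)
    (hξ : DataSamples P D ξ) (hνξ : NoiseIndepData P ν ξ) {β : Type*} [MeasurableSpace β]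
    {k : ℕ} {Y : Ω → β} (hY : Measurable[pastSigma ν ξ k] Y) (i : V) (l : ℕ) :
    IndepFun Y (ξ i k l) P := by
  have h1 : Indep (pastSigma ν ξ k) (dataSigma ξ {(k, l)}) P := by
    rw [pastSigma, sup_comm]
    refine indep_sup_left_of_indep (hξ.dataSigma_le _) (hν.noiseSigma_le _) (hξ.dataSigma_le _)
      ?_ ?_
    · exact indep_of_indep_of_le_left (hνξ.indep_noiseSigma_dataSigma _ Set.univ).symm
        (sup_le (dataSigma_mono (Set.subset_univ _)) (dataSigma_mono (Set.subset_univ _)))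
    · exact indep_iSup_of_disjoint
        (m := fun p : ℕ × ℕ => MeasurableSpace.comap (fun ω i => ξ i p.1 p.2 ω) inferInstance)
        (fun p => (measurable_pi_lambda _ fun i => hξ.measurable i p.1 p.2).comap_le) hξ.indep
        (by simp)
  refine indep_of_indep_of_le_left (indep_of_indep_of_le_right h1 ?_) hY.comap_le
  have h2 : Measurable[dataSigma ξ {(k, l)}] (fun ω i => ξ i k l ω) := by
    refine Measurable.mono (comap_measurable _) ?_ le_rfl
    exact le_iSup₂_of_le (f := fun (p : ℕ × ℕ) (_ : p ∈ ({(k, l)} : Set (ℕ × ℕ))) =>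
        MeasurableSpace.comap (fun ω i => ξ i p.1 p.2 ω) inferInstance) (k, l) rfl le_rfl
  exact ((measurable_pi_apply i).comp h2).comap_le

end Independence

/-! ### Uncorrelated perturbations -/

section CenteredNoise

variable {Ω : Type*} [MeasurableSpace Ω] {P : Measure Ω}
  {F : Type*} [NormedAddCommGroup F] [InnerProductSpace ℝ F]

theorem integrable_inner_of_memLp {T S : Ω → F} (hT : MemLp T 2 P) (hS : MemLp S 2 P) :
    Integrable (fun ω => inner ℝ (T ω) (S ω)) P := by
  refine (hT.norm.integrable_mul hS.norm).mono' (hT.1.inner hS.1) (ae_of_all _ fun ω => ?_)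
  simpa using norm_inner_le_norm (𝕜 := ℝ) (T ω) (S ω)

/-- `S` is square integrable with second moment at most `C`, and orthogonal to `T` in `L²`: a
random perturbation that does not correlate with the state-dependent quantity `T`. -/
structure UncorrelatedNoise (P : Measure Ω) (T : Ω → F) (C : ℝ) (S : Ω → F) : Prop where
  memLp : MemLp S 2 P
  integral_inner : ∫ ω, inner ℝ (T ω) (S ω) ∂P = 0
  integral_norm_sq_le : ∫ ω, ‖S ω‖ ^ 2 ∂P ≤ C

/-- Averaging noises that are uncorrelated with `T`, but possibly correlated among themselves, does
not increase the bound on the second moment. -/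
theorem UncorrelatedNoise.weighted_sum {T : Ω → F} (hT : MemLp T 2 P) {C : ℝ} {ι : Type*}
    {s : Finset ι} {a : ι → ℝ} (ha : ∀ j ∈ s, 0 ≤ a j) (ha1 : ∑ j ∈ s, a j = 1) {S : ι → Ω → F}
    (hS : ∀ j ∈ s, UncorrelatedNoise P T C (S j)) :
    UncorrelatedNoise P T C (fun ω => ∑ j ∈ s, a j • S j ω) := by
  have hmem : MemLp (fun ω => ∑ j ∈ s, a j • S j ω) 2 P :=
    memLp_finsetSum s fun j hj => (hS j hj).memLp.const_smul (a j)
  have hsq : ∀ j ∈ s, Integrable (fun ω => ‖S j ω‖ ^ 2) P := fun j hj =>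
    (memLp_two_iff_integrable_sq_norm (hS j hj).memLp.1).1 (hS j hj).memLp
  refine ⟨hmem, ?_, ?_⟩
  · simp_rw [inner_sum, inner_smul_right]
    rw [integral_finsetSum _ fun j hj =>
      (integrable_inner_of_memLp hT (hS j hj).memLp).const_mul (a j)]
    refine Finset.sum_eq_zero fun j hj => ?_
    rw [integral_const_mul, (hS j hj).integral_inner, mul_zero]
  · calc ∫ ω, ‖∑ j ∈ s, a j • S j ω‖ ^ 2 ∂P ≤ ∫ ω, ∑ j ∈ s, a j * ‖S j ω‖ ^ 2 ∂P :=
          integral_mono ((memLp_two_iff_integrable_sq_norm hmem.1).1 hmem)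
            (integrable_finsetSum s fun j hj => (hsq j hj).const_mul (a j))
            fun ω => norm_sum_smul_sq_le s ha ha1 fun j => S j ω
      _ = ∑ j ∈ s, a j * ∫ ω, ‖S j ω‖ ^ 2 ∂P := by
          rw [integral_finsetSum s fun j hj => (hsq j hj).const_mul (a j)]
          simp_rw [integral_const_mul]
      _ ≤ ∑ j ∈ s, a j * C := Finset.sum_le_sum fun j hj =>
          mul_le_mul_of_nonneg_left (hS j hj).integral_norm_sq_le (ha j hj)
      _ = C := by rw [← Finset.sum_mul, ha1, one_mul]

/-- The noises `S` and `R` may be correlated with each other, whence the factors `2`. -/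
theorem integral_norm_add_noise_sq_le {T S R : Ω → F} {CS CR : ℝ} (hT : MemLp T 2 P)
    (hS : UncorrelatedNoise P T CS S) (hR : UncorrelatedNoise P T CR R) (α β : ℝ) :
    ∫ ω, ‖T ω + β • S ω - α • R ω‖ ^ 2 ∂P ≤
      ∫ ω, ‖T ω‖ ^ 2 ∂P + (2 * β ^ 2 * CS + 2 * α ^ 2 * CR) := by
  have hpt : ∀ ω, ‖T ω + β • S ω - α • R ω‖ ^ 2 ≤ ‖T ω‖ ^ 2
      + (2 * β * inner ℝ (T ω) (S ω) - 2 * α * inner ℝ (T ω) (R ω))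
      + (2 * β ^ 2 * ‖S ω‖ ^ 2 + 2 * α ^ 2 * ‖R ω‖ ^ 2) := by
    intro ω
    have h := parallelogram_law_with_norm ℝ (β • S ω) (α • R ω)
    simp only [norm_smul, mul_pow, Real.norm_eq_abs, sq_abs] at h
    rw [add_sub_assoc, norm_add_sq_real, inner_sub_right, inner_smul_right, inner_smul_right]
    nlinarith [sq_nonneg ‖β • S ω + α • R ω‖]
  have hsq : ∀ {U : Ω → F}, MemLp U 2 P → Integrable (fun ω => ‖U ω‖ ^ 2) P := fun hU =>
    (memLp_two_iff_integrable_sq_norm hU.1).1 hU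
  have i1 := hsq hT
  have i2 := (integrable_inner_of_memLp hT hS.memLp).const_mul (2 * β)
  have i3 := (integrable_inner_of_memLp hT hR.memLp).const_mul (2 * α)
  have i4 := (hsq hS.memLp).const_mul (2 * β ^ 2)
  have i5 := (hsq hR.memLp).const_mul (2 * α ^ 2)
  calc ∫ ω, ‖T ω + β • S ω - α • R ω‖ ^ 2 ∂P ≤ _ :=
        integral_mono (hsq ((hT.add (hS.memLp.const_smul β)).sub (hR.memLp.const_smul α)))
          ((i1.add (i2.sub i3)).add (i4.add i5)) hpt
    _ = ∫ ω, ‖T ω‖ ^ 2 ∂P + (2 * β ^ 2 * ∫ ω, ‖S ω‖ ^ 2 ∂P + 2 * α ^ 2 * ∫ ω, ‖R ω‖ ^ 2 ∂P) := by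
        refine (integral_add (i1.add (i2.sub i3)) (i4.add i5)).trans ?_
        rw [integral_add' i4 i5, integral_add' i1 (i2.sub i3), integral_sub' i2 i3]
        simp only [integral_const_mul, hS.integral_inner, hR.integral_inner]
        ring
    _ ≤ _ := by
        have h1 := hS.integral_norm_sq_le
        have h2 := hR.integral_norm_sq_le
        gcongr

variable [CompleteSpace F] [MeasurableSpace F] [BorelSpace F] [SecondCountableTopology F]

/-- If `Z` is independent of `Y` and `h y Z` is centered with second moment at most `C` for every
fixed `y`, then `h Y Z` is uncorrelated with every square integrable function of `Y`, by Fubini's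
theorem. -/
theorem uncorrelatedNoise_of_indepFun [IsProbabilityMeasure P] {α β : Type*} [MeasurableSpace α]
    [MeasurableSpace β] {Y : Ω → α} {Z : Ω → β} (hY : Measurable Y) (hZ : Measurable Z)
    (hYZ : IndepFun Y Z P) {h : α → β → F} (hh : Measurable (Function.uncurry h)) {C : ℝ}
    (hmem : ∀ y, MemLp (h y) 2 (P.map Z)) (hmean : ∀ y, ∫ s, h y s ∂(P.map Z) = 0)
    (hC : ∀ y, ∫ s, ‖h y s‖ ^ 2 ∂(P.map Z) ≤ C) {T : α → F} (hT : Measurable T)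
    (hT2 : MemLp (fun ω => T (Y ω)) 2 P) :
    UncorrelatedNoise P (fun ω => T (Y ω)) C (fun ω => h (Y ω) (Z ω)) := by
  have : IsProbabilityMeasure (P.map Z) := Measure.isProbabilityMeasure_map hZ.aemeasurable
  have : IsProbabilityMeasure (P.map Y) := Measure.isProbabilityMeasure_map hY.aemeasurable
  have hmap := (indepFun_iff_map_prod_eq_prod_map_map hY.aemeasurable hZ.aemeasurable).1 hYZ
  have hYZm : Measurable fun ω => (Y ω, Z ω) := hY.prodMk hZ
  set Q := (P.map Y).prod (P.map Z)
  have hsqm : StronglyMeasurable fun q : α × β => ‖Function.uncurry h q‖ ^ 2 :=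
    (hh.norm.pow_const 2).stronglyMeasurable
  have hsq : Integrable (fun q : α × β => ‖Function.uncurry h q‖ ^ 2) Q := by
    rw [integrable_prod_iff hsqm.aestronglyMeasurable]
    refine ⟨ae_of_all _ fun y => (memLp_two_iff_integrable_sq_norm (hmem y).1).1 (hmem y), ?_⟩
    refine (integrable_const C).mono' hsqm.norm.integral_prod_right'.aestronglyMeasurable
      (ae_of_all _ fun y => ?_)
    rw [Real.norm_of_nonneg (integral_nonneg fun s => norm_nonneg _)]
    simpa using hC y
  have hLp : MemLp (Function.uncurry h) 2 Q :=
    (memLp_two_iff_integrable_sq_norm hh.aestronglyMeasurable).2 hsq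
  have hLpP : MemLp (fun ω => h (Y ω) (Z ω)) 2 P := by
    rw [← hmap] at hLp
    exact hLp.comp_of_map hYZm.aemeasurable
  refine ⟨hLpP, ?_, ?_⟩
  · have hinm : Measurable fun q : α × β => inner ℝ (T q.1) (Function.uncurry h q) :=
      (hT.comp measurable_fst).inner hh
    have hint : Integrable (fun q : α × β => inner ℝ (T q.1) (Function.uncurry h q)) Q := by
      rw [← hmap, integrable_map_measure hinm.aestronglyMeasurable hYZm.aemeasurable]
      exact integrable_inner_of_memLp hT2 hLpP
    calc ∫ ω, inner ℝ (T (Y ω)) (h (Y ω) (Z ω)) ∂P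
        = ∫ q, inner ℝ (T q.1) (Function.uncurry h q) ∂Q := by
          rw [← hmap, integral_map hYZm.aemeasurable hinm.aestronglyMeasurable]
          rfl
      _ = ∫ y, ∫ s, inner ℝ (T y) (h y s) ∂(P.map Z) ∂(P.map Y) := integral_prod _ hint
      _ = 0 := by
          simp_rw [integral_inner ((hmem _).integrable one_le_two), hmean, inner_zero_right]
          simp
  · calc ∫ ω, ‖h (Y ω) (Z ω)‖ ^ 2 ∂P = ∫ q, ‖Function.uncurry h q‖ ^ 2 ∂Q := by
          rw [← hmap, integral_map hYZm.aemeasurable hsqm.aestronglyMeasurable]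
          rfl
      _ = ∫ y, ∫ s, ‖h y s‖ ^ 2 ∂(P.map Z) ∂(P.map Y) := integral_prod _ hsq
      _ ≤ ∫ _, C ∂(P.map Y) := integral_mono hsq.integral_prod_left (integrable_const C) hC
      _ = C := by simp

end CenteredNoise

/-! ### Regular costs and their minimizer -/

section Costs

variable {V : Type*} {d : ℕ} {f : V → EuclideanSpace ℝ (Fin d) → ℝ} {μ : ℝ}

theorem RegularCosts.exists_lipschitz [Fintype V] (hf : RegularCosts f μ) :
    ∃ L : ℝ, 0 ≤ L ∧ ∀ i x y, ‖∇ (f i) x - ∇ (f i) y‖ ≤ L * ‖x - y‖ := by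
  choose L hL h using hf.lipschitz
  refine ⟨∑ i, L i, Finset.sum_nonneg fun i _ => (hL i).le, fun i x y => (h i x y).trans ?_⟩
  exact mul_le_mul_of_nonneg_right
    (Finset.single_le_sum (fun j _ => (hL j).le) (Finset.mem_univ i)) (norm_nonneg _)

theorem RegularCosts.continuous_gradient (hf : RegularCosts f μ) (i : V) :
    Continuous (∇ (f i)) := by
  obtain ⟨L, hL, h⟩ := hf.lipschitz i
  refine (LipschitzWith.of_dist_le_mul (K := L.toNNReal) fun x y => ?_).continuous
  rw [dist_eq_norm, dist_eq_norm, Real.coe_toNNReal L hL.le]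
  exact h x y

/-- The total cost is strongly convex with Lipschitz gradient, so its gradient vanishes at exactly
one point, which is the unique minimizer. -/
theorem RegularCosts.exists_minimizer [Fintype V] [Nonempty V] (hf : RegularCosts f μ) :
    ∃ xs, (∀ y, y ≠ xs → ∑ i, f i xs < ∑ i, f i y) ∧ ∑ i, ∇ (f i) xs = 0 := by
  obtain ⟨L, -, hL⟩ := hf.exists_lipschitz
  have hgrad : ∀ x, ∇ (fun y => ∑ i, f i y) x = ∑ i, ∇ (f i) x := fun x => by
    refine HasGradientAt.gradient ?_
    rw [hasGradientAt_iff_hasFDerivAt, map_sum]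
    exact HasFDerivAt.fun_sum fun i _ => (hf.differentiable i x).hasGradientAt.hasFDerivAt
  have hcard : 0 < (Fintype.card V : ℝ) := by exact_mod_cast Fintype.card_pos
  have hmono : ∀ x y, (Fintype.card V * μ) * ‖x - y‖ ^ 2 ≤
      inner ℝ (∑ i, ∇ (f i) x - ∑ i, ∇ (f i) y) (x - y) := fun x y => by
    rw [← Finset.sum_sub_distrib, sum_inner]
    refine le_trans (le_of_eq ?_) (Finset.sum_le_sum fun i _ => hf.strongly_convex i x y)
    simp [mul_assoc]
  have hlip : ∀ x y, ‖∑ i, ∇ (f i) x - ∑ i, ∇ (f i) y‖ ≤ (Fintype.card V * L) * ‖x - y‖ :=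
    fun x y => by
      rw [← Finset.sum_sub_distrib]
      refine (norm_sum_le_of_le _ fun i _ => hL i x y).trans (le_of_eq ?_)
      simp [mul_assoc]
  obtain ⟨xs, hxs⟩ :=
    exists_zero_of_strongly_monotone (mul_pos hcard hf.mu_pos) hlip hmono
  refine ⟨xs, fun y hy => ?_, hxs⟩
  refine lt_of_gradient_eq_zero (f := fun y => ∑ i, f i y) (mul_pos hcard hf.mu_pos)
    (Differentiable.fun_sum fun i _ => hf.differentiable i) (fun x y => ?_) ?_ hy
  · rw [hgrad, hgrad]
    exact hmono x y
  · rw [hgrad, hxs]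

theorem RegularCosts.memLp_gradient_comp (hf : RegularCosts f μ) {Ω : Type*} [MeasurableSpace Ω]
    {P : Measure Ω} [IsProbabilityMeasure P] (i : V) {X : Ω → EuclideanSpace ℝ (Fin d)}
    (hX : MemLp X 2 P) : MemLp (fun ω => ∇ (f i) (X ω)) 2 P := by
  obtain ⟨L, hL, h⟩ := hf.lipschitz i
  have h1 : MemLp (fun ω => ∇ (f i) (X ω) - ∇ (f i) 0) 2 P := by
    refine hX.of_le_mul (c := L) ?_ (ae_of_all _ fun ω => ?_)
    · exact ((hf.continuous_gradient i).comp_aestronglyMeasurable hX.1).sub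
        aestronglyMeasurable_const
    · simpa using h (X ω) 0
  exact (h1.add (memLp_const (∇ (f i) 0))).ae_eq (ae_of_all _ fun ω => by simp)

end Costs

/-! ### The error recursion of the iterates -/

section Iterates

variable {V : Type*} [Fintype V] {d : ℕ} {Ξ : V → Type*} [∀ i, MeasurableSpace (Ξ i)]
  {Ω : Type*} [MeasurableSpace Ω] {P : Measure Ω} [IsProbabilityMeasure P]
  {D : ∀ i, Measure (Ξ i)} {f : V → EuclideanSpace ℝ (Fin d) → ℝ} {μ : ℝ}
  {g : ∀ i, EuclideanSpace ℝ (Fin d) → Ξ i → EuclideanSpace ℝ (Fin d)} {σg : ℝ}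
  {G : SimpleGraph V} {A : Matrix V V ℝ} {σ : ℕ → ℝ≥0}
  {ν : V → ℕ → Ω → EuclideanSpace ℝ (Fin d)} {ξ : ∀ i, ℕ → ℕ → Ω → Ξ i}
  {stepα stepβ : ℕ → ℝ} {N : ℕ → ℕ} {x₀ : V → EuclideanSpace ℝ (Fin d)}

omit [MeasurableSpace Ω] in
theorem measurable_iterate_pastSigma (hg : ∀ i, Measurable (Function.uncurry (g i))) (k : ℕ)
    (i : V) : Measurable[pastSigma ν ξ k] (iterate A stepα stepβ N g x₀ ν ξ k i) := by
  induction k generalizing i with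
  | zero => exact measurable_const
  | succ k ih =>
    have hx : ∀ j, Measurable[pastSigma ν ξ (k + 1)] (iterate A stepα stepβ N g x₀ ν ξ k j) :=
      fun j => (ih j).mono (pastSigma_mono k.le_succ) le_rfl
    have hn : ∀ j, Measurable[pastSigma ν ξ (k + 1)] (ν j k) := fun j =>
      measurable_noise_pastSigma k.lt_succ_self
    have hs : ∀ l, Measurable[pastSigma ν ξ (k + 1)]
        (fun ω => g i (iterate A stepα stepβ N g x₀ ν ξ k i ω) (ξ i k l ω)) := fun l =>
      (hg i).comp ((hx i).prodMk (measurable_data_pastSigma k.lt_succ_self))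
    exact (((hx i).const_smul (1 - stepβ k)).add ((Finset.measurable_fun_sum _ fun j _ =>
      ((hx j).add (hn j)).const_smul (A i j)).const_smul (stepβ k))).sub
        (((Finset.measurable_fun_sum _ fun l _ => hs l).const_smul ((N k : ℝ)⁻¹)).const_smul
          (stepα k))

/-- Given the past, the noise that agent `j` adds at time `k` is centered. -/
theorem uncorrelatedNoise_privacy (hg : GradientOracle D f g σg) (hν : PrivacyNoise P σ ν)
    (hξ : DataSamples P D ξ) (hνξ : NoiseIndepData P ν ξ) (k : ℕ) (j : V)
    {T : (V → EuclideanSpace ℝ (Fin d)) → EuclideanSpace ℝ (Fin d)} (hT : Measurable T)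
    (hT2 : MemLp (fun ω => T fun i => iterate A stepα stepβ N g x₀ ν ξ k i ω) 2 P) :
    UncorrelatedNoise P (fun ω => T fun i => iterate A stepα stepβ N g x₀ ν ξ k i ω)
      (d * (2 * (σ k : ℝ) ^ 2)) (ν j k) := by
  have hY : Measurable[pastSigma ν ξ k] fun ω i => iterate A stepα stepβ N g x₀ ν ξ k i ω :=
    @measurable_pi_lambda _ _ _ (pastSigma ν ξ k) _ _ fun i =>
      measurable_iterate_pastSigma hg.measurable k i
  have hm := (hν.measurable j k).aemeasurable (μ := P)
  refine uncorrelatedNoise_of_indepFun (hY.mono (pastSigma_le hν hξ k) le_rfl)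
    (hν.measurable j k) (indepFun_noise_of_past hν hξ hνξ hY j)
    (h := fun _ s => s) measurable_snd (fun _ => ?_) (fun _ => ?_) (fun _ => ?_) hT hT2
  · exact (memLp_map_measure_iff (g := fun s => s) (by fun_prop) hm).2 (hν.memLp j k)
  · rw [integral_map (f := fun s => s) hm (by fun_prop), hν.integral_eq_zero]
  · rw [integral_map (f := fun s => ‖s‖ ^ 2) hm (by fun_prop), hν.integral_norm_sq]

/-- Given the past, the error of a sampled gradient of agent `i` at time `k` is centered. -/
theorem uncorrelatedNoise_gradient [∀ i, IsProbabilityMeasure (D i)] (hf : RegularCosts f μ)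
    (hg : GradientOracle D f g σg)
    (hν : PrivacyNoise P σ ν) (hξ : DataSamples P D ξ) (hνξ : NoiseIndepData P ν ξ) (k l : ℕ)
    (i : V) {T : (V → EuclideanSpace ℝ (Fin d)) → EuclideanSpace ℝ (Fin d)} (hT : Measurable T)
    (hT2 : MemLp (fun ω => T fun i => iterate A stepα stepβ N g x₀ ν ξ k i ω) 2 P) :
    UncorrelatedNoise P (fun ω => T fun i => iterate A stepα stepβ N g x₀ ν ξ k i ω)
      (σg ^ 2) (fun ω => g i (iterate A stepα stepβ N g x₀ ν ξ k i ω) (ξ i k l ω)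
        - ∇ (f i) (iterate A stepα stepβ N g x₀ ν ξ k i ω)) := by
  have hY : Measurable[pastSigma ν ξ k] fun ω i => iterate A stepα stepβ N g x₀ ν ξ k i ω :=
    @measurable_pi_lambda _ _ _ (pastSigma ν ξ k) _ _ fun i =>
      measurable_iterate_pastSigma hg.measurable k i
  have hgrad := (hf.continuous_gradient i).measurable
  refine uncorrelatedNoise_of_indepFun (hY.mono (pastSigma_le hν hξ k) le_rfl)
    (hξ.measurable i k l) (indepFun_data_of_past hν hξ hνξ hY i l)
    (h := fun y s => g i (y i) s - ∇ (f i) (y i)) ?_ (fun y => ?_) (fun y => ?_) (fun y => ?_)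
    hT hT2
  · have h1 : Measurable fun q : (V → EuclideanSpace ℝ (Fin d)) × Ξ i => q.1 i :=
      (measurable_pi_apply i).comp measurable_fst
    exact ((hg.measurable i).comp (h1.prodMk measurable_snd)).sub (hgrad.comp h1)
  · rw [hξ.law]
    exact (hg.memLp i (y i)).sub (memLp_const _)
  · rw [hξ.law, integral_sub ((hg.memLp i (y i)).integrable one_le_two) (integrable_const _),
      hg.unbiased]
    simp
  · rw [hξ.law]
    exact hg.variance_le i (y i)

theorem memLp_iterate [∀ i, IsProbabilityMeasure (D i)] (hf : RegularCosts f μ)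
    (hg : GradientOracle D f g σg) (hν : PrivacyNoise P σ ν) (hξ : DataSamples P D ξ)
    (hνξ : NoiseIndepData P ν ξ) (k : ℕ) (i : V) :
    MemLp (iterate A stepα stepβ N g x₀ ν ξ k i) 2 P := by
  induction k generalizing i with
  | zero => exact memLp_const (x₀ i)
  | succ k ih =>
    have hs : ∀ l, MemLp
        (fun ω => g i (iterate A stepα stepβ N g x₀ ν ξ k i ω) (ξ i k l ω)) 2 P := fun l => by
      have h1 := (uncorrelatedNoise_gradient (A := A) (stepα := stepα) (stepβ := stepβ) (N := N)
        (x₀ := x₀) hf hg hν hξ hνξ k l i (T := fun _ => 0) measurable_const (memLp_const 0)).memLp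
      exact (h1.add (hf.memLp_gradient_comp i (ih i))).ae_eq (ae_of_all _ fun ω => by simp)
    exact (((ih i).const_smul (1 - stepβ k)).add ((memLp_finsetSum _ fun j _ =>
      ((ih j).add (hν.memLp j k)).const_smul (A i j)).const_smul (stepβ k))).sub
        (((memLp_finsetSum _ fun l _ => hs l).const_smul ((N k : ℝ)⁻¹)).const_smul (stepα k))

/-- The one-step recursion for the total mean square error. Privacy and sampling noise are
uncorrelated with the noiseless step, so they only add their second moments. -/
theorem sum_integral_norm_sq_succ_le [∀ i, IsProbabilityMeasure (D i)] (hf : RegularCosts f μ)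
    (hg : GradientOracle D f g σg) (hA : NetworkWeights G A) (hν : PrivacyNoise P σ ν)
    (hξ : DataSamples P D ξ) (hνξ : NoiseIndepData P ν ξ) {xs : EuclideanSpace ℝ (Fin d)}
    {L K : ℝ} (hL : ∀ i x y, ‖∇ (f i) x - ∇ (f i) y‖ ≤ L * ‖x - y‖) (hK : 0 ≤ K)
    (hxs : ∀ z : V → EuclideanSpace ℝ (Fin d),
      (∑ i, inner ℝ (∇ (f i) xs) (z i)) ^ 2 ≤ K * disagreement A z) {k : ℕ}
    (hα : 0 ≤ stepα k) (hβ : 0 < stepβ k) (hβ4 : stepβ k ≤ 1 / 4) (hN : N k ≠ 0) :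
    ∑ i, ∫ ω, ‖iterate A stepα stepβ N g x₀ ν ξ (k + 1) i ω - xs‖ ^ 2 ∂P ≤
      (1 - 2 * μ * stepα k + 4 * L ^ 2 * stepα k ^ 2) *
        ∑ i, ∫ ω, ‖iterate A stepα stepβ N g x₀ ν ξ k i ω - xs‖ ^ 2 ∂P
      + (4 * (∑ i, ‖∇ (f i) xs‖ ^ 2) * stepα k ^ 2 + 2 * K * (stepα k ^ 2 / stepβ k))
      + Fintype.card V *
        (2 * stepβ k ^ 2 * (d * (2 * (σ k : ℝ) ^ 2)) + 2 * stepα k ^ 2 * σg ^ 2) := by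
  set x := iterate A stepα stepβ N g x₀ ν ξ with hx
  have hxL : ∀ i, MemLp (x k i) 2 P := fun i => memLp_iterate hf hg hν hξ hνξ k i
  set T : V → (V → EuclideanSpace ℝ (Fin d)) → EuclideanSpace ℝ (Fin d) := fun i y =>
    (y i - xs) + stepβ k • (∑ j, A i j • ((y j - xs) - (y i - xs))) - stepα k • ∇ (f i) (y i)
    with hTdef
  have hT : ∀ i, Measurable (T i) := fun i => by
    have := fun i => (hf.continuous_gradient i).measurable
    fun_prop
  have hTL : ∀ i, MemLp (fun ω => T i fun j => x k j ω) 2 P := fun i => by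
    have h1 : ∀ j, MemLp (fun ω => x k j ω - xs) 2 P := fun j => (hxL j).sub (memLp_const xs)
    exact ((h1 i).add ((memLp_finsetSum _ fun j _ =>
      ((h1 j).sub (h1 i)).const_smul (A i j)).const_smul (stepβ k))).sub
        ((hf.memLp_gradient_comp i (hxL i)).const_smul (stepα k))
  have hsq : ∀ {U : Ω → EuclideanSpace ℝ (Fin d)}, MemLp U 2 P →
      Integrable (fun ω => ‖U ω‖ ^ 2) P := fun hU => (memLp_two_iff_integrable_sq_norm hU.1).1 hU
  have hstep : ∀ i, ∫ ω, ‖x (k + 1) i ω - xs‖ ^ 2 ∂P ≤ ∫ ω, ‖T i fun j => x k j ω‖ ^ 2 ∂P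
      + (2 * stepβ k ^ 2 * (d * (2 * (σ k : ℝ) ^ 2)) + 2 * stepα k ^ 2 * σg ^ 2) := by
    intro i
    have hS := UncorrelatedNoise.weighted_sum (hTL i) (s := Finset.univ) (a := A i)
      (fun j _ => hA.nonneg i j) (hA.row_sum i)
      fun j _ => uncorrelatedNoise_privacy hg hν hξ hνξ k j (hT i) (hTL i)
    have hR := UncorrelatedNoise.weighted_sum (hTL i) (s := Finset.range (N k))
      (a := fun _ => (N k : ℝ)⁻¹) (fun _ _ => by positivity) (by simp [hN])
      fun l _ => uncorrelatedNoise_gradient hf hg hν hξ hνξ k l i (hT i) (hTL i)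
    refine le_trans (le_of_eq (integral_congr_ae (ae_of_all _ fun ω => ?_)))
      (integral_norm_add_noise_sq_le (hTL i) hS hR (stepα k) (stepβ k))
    have hN' : (N k : ℝ) ≠ 0 := Nat.cast_ne_zero.2 hN
    have e1 : ∑ j, A i j • (x k j ω + ν j k ω) =
        ∑ j, A i j • ((x k j ω - xs) - (x k i ω - xs)) + x k i ω + ∑ j, A i j • ν j k ω := by
      simp only [sub_sub_sub_cancel_right, smul_add, smul_sub, Finset.sum_add_distrib,
        Finset.sum_sub_distrib, ← Finset.sum_smul, hA.row_sum, one_smul]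
      abel
    have e2 : ∑ l ∈ Finset.range (N k), (N k : ℝ)⁻¹ • (g i (x k i ω) (ξ i k l ω)
        - ∇ (f i) (x k i ω)) =
        (N k : ℝ)⁻¹ • ∑ l ∈ Finset.range (N k), g i (x k i ω) (ξ i k l ω)
          - ∇ (f i) (x k i ω) := by
      rw [← Finset.smul_sum, Finset.sum_sub_distrib, smul_sub, Finset.sum_const, Finset.card_range,
        ← Nat.cast_smul_eq_nsmul ℝ, smul_smul, inv_mul_cancel₀ hN', one_smul]
    have e3 : x (k + 1) i ω = (1 - stepβ k) • x k i ω
        + stepβ k • ∑ j, A i j • (x k j ω + ν j k ω)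
        - stepα k • ((N k : ℝ)⁻¹ • ∑ l ∈ Finset.range (N k), g i (x k i ω) (ξ i k l ω)) := rfl
    simp only [← hx, hTdef]
    rw [e3, e1, e2]
    congr 2
    module
  have hdet : ∑ i, ∫ ω, ‖T i fun j => x k j ω‖ ^ 2 ∂P ≤
      (1 - 2 * μ * stepα k + 4 * L ^ 2 * stepα k ^ 2) * ∑ i, ∫ ω, ‖x k i ω - xs‖ ^ 2 ∂P
      + (4 * (∑ i, ‖∇ (f i) xs‖ ^ 2) * stepα k ^ 2 + 2 * K * (stepα k ^ 2 / stepβ k)) := by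
    have h1 : ∀ i, Integrable (fun ω => ‖x k i ω - xs‖ ^ 2) P := fun i =>
      hsq ((hxL i).sub (memLp_const xs))
    have h2 := integrable_finsetSum Finset.univ fun i _ => h1 i
    rw [← integral_finsetSum _ fun i _ => hsq (hTL i), ← integral_finsetSum _ fun i _ => h1 i,
      ← integral_const_mul]
    refine (integral_mono (integrable_finsetSum _ fun i _ => hsq (hTL i))
      ((h2.const_mul _).add (integrable_const _)) fun ω =>
        hA.sum_norm_step_sq_le (z := fun i => x k i ω - xs) (g := fun i => ∇ (f i) (x k i ω))
          (h := fun i => ∇ (f i) xs) hK hα hβ hβ4 (fun i => hL i _ _)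
          (fun i => hf.strongly_convex i _ _) (hxs _)).trans (le_of_eq ?_)
    refine (integral_add (h2.const_mul _) (integrable_const _)).trans ?_
    simp
  calc ∑ i, ∫ ω, ‖x (k + 1) i ω - xs‖ ^ 2 ∂P ≤ _ := Finset.sum_le_sum fun i _ => hstep i
    _ = ∑ i, ∫ ω, ‖T i fun j => x k j ω‖ ^ 2 ∂P + Fintype.card V *
        (2 * stepβ k ^ 2 * (d * (2 * (σ k : ℝ) ^ 2)) + 2 * stepα k ^ 2 * σg ^ 2) := by
      rw [Finset.sum_add_distrib, Finset.sum_const, Finset.card_univ, nsmul_eq_mul]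
    _ ≤ _ := by gcongr

end Iterates

/-! ### Convergence rates -/

theorem tendsto_natCast_add_atTop (a : ℝ) : Tendsto (fun k : ℕ => (k : ℝ) + a) atTop atTop :=
  tendsto_atTop_add_const_right _ a tendsto_natCast_atTop_atTop

/-- The rate produced by the error recursion for polynomial step sizes. For `α = 1` the decay
exponent is limited by the contraction factor `1 - a₁ * μ / k`. -/
theorem isBigO_of_polynomial_steps {u : ℕ → ℝ} (hu : ∀ k, 0 ≤ u k) {σ : ℕ → ℝ≥0}
    {μ a₁ a₂ α β η p c₁ c₂ c₃ c₄ : ℝ} (hμ : 0 < μ) (ha₁ : 0 < a₁) (ha₂ : 0 < a₂) (hβ : 0 < β)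
    (hβα : β < α) (hc₂ : 0 ≤ c₂) (hc₃ : 0 ≤ c₃) (hc₄ : 0 ≤ c₄)
    (hσ : (fun k : ℕ => (σ k : ℝ)) =O[atTop] fun k : ℕ => ((k : ℝ) + a₂) ^ η)
    (hp : p ≤ α - β) (hpη : p ≤ 2 * β - 2 * η - α) (hpα : α < 1 ∨ α = 1 ∧ p < a₁ * μ)
    (hrec : ∀ᶠ k : ℕ in atTop, u (k + 1) ≤
      (1 - 2 * μ * (a₁ / ((k : ℝ) + a₂) ^ α) + c₁ * (a₁ / ((k : ℝ) + a₂) ^ α) ^ 2) * u k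
      + (c₂ * (a₁ / ((k : ℝ) + a₂) ^ α) ^ 2
        + c₃ * ((a₁ / ((k : ℝ) + a₂) ^ α) ^ 2 / (a₁ / ((k : ℝ) + a₂) ^ β))
        + c₄ * ((a₁ / ((k : ℝ) + a₂) ^ β) ^ 2 * (σ k : ℝ) ^ 2))) :
    u =O[atTop] fun k : ℕ => ((k : ℝ) + a₂) ^ (-p) := by
  have hα : 0 < α := hβ.trans hβα
  have hb : 0 < a₁ * μ := mul_pos ha₁ hμ
  obtain ⟨c, hc, hσc⟩ := hσ.exists_pos
  have hrate : ∃ b' < a₁ * μ, ∀ᶠ k : ℕ in atTop,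
      max p 0 / ((k : ℝ) + a₂) ≤ b' * ((k : ℝ) + a₂) ^ (-α) := by
    rcases hpα with h | ⟨rfl, h⟩
    · refine ⟨a₁ * μ / 2, by linarith, ?_⟩
      have h1 : Tendsto (fun k : ℕ => ((k : ℝ) + a₂) ^ (1 - α)) atTop atTop :=
        (tendsto_rpow_atTop (by linarith)).comp (tendsto_natCast_add_atTop a₂)
      filter_upwards [h1.eventually_ge_atTop (max p 0 / (a₁ * μ / 2))] with k hk
      have ht : 0 < (k : ℝ) + a₂ := by positivity
      rw [div_le_iff₀ (by linarith)] at hk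
      rw [div_le_iff₀ ht, mul_assoc]
      nth_rewrite 2 [← Real.rpow_one ((k : ℝ) + a₂)]
      rw [← Real.rpow_add ht, mul_comm (a₁ * μ / 2), neg_add_eq_sub]
      exact hk
    · refine ⟨max p 0, max_lt h hb, Eventually.of_forall fun k => ?_⟩
      rw [Real.rpow_neg_one, div_eq_mul_inv]
  obtain ⟨b', hb', hrate⟩ := hrate
  have hlim : Tendsto (fun k : ℕ => c₁ * (a₁ * ((k : ℝ) + a₂) ^ (-α))) atTop
      (nhds (c₁ * (a₁ * 0))) :=
    (((tendsto_rpow_neg_atTop hα).comp (tendsto_natCast_add_atTop a₂)).const_mul a₁).const_mul c₁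
  rw [mul_zero, mul_zero] at hlim
  refine isBigO_rpow_neg_of_recursion (C := c₂ * a₁ ^ 2 + c₃ * a₁ + c₄ * (a₁ ^ 2 * c ^ 2)) hu ha₂ hα
    hb' hrate ?_
  filter_upwards [hrec, hσc.bound, hlim.eventually (eventually_le_nhds hμ),
    (tendsto_natCast_add_atTop a₂).eventually_ge_atTop 1] with k h1 h2 h3 h4
  set t := (k : ℝ) + a₂
  have ht : 0 < t := by linarith
  have hq : 0 ≤ t ^ (-α) := Real.rpow_nonneg ht.le _
  have eα : a₁ / t ^ α = a₁ * t ^ (-α) := by rw [Real.rpow_neg ht.le, div_eq_mul_inv]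
  have eβ : a₁ / t ^ β = a₁ * t ^ (-β) := by rw [Real.rpow_neg ht.le, div_eq_mul_inv]
  rw [Real.norm_of_nonneg (σ k).coe_nonneg, Real.norm_of_nonneg (Real.rpow_nonneg ht.le _)] at h2
  have b1 : (a₁ / t ^ α) ^ 2 ≤ a₁ ^ 2 * t ^ (-α - p) := by
    rw [eα, mul_pow, ← Real.rpow_mul_natCast ht.le]
    refine mul_le_mul_of_nonneg_left (Real.rpow_le_rpow_of_exponent_le h4 ?_) (by positivity)
    push_cast
    linarith
  have b2 : (a₁ / t ^ α) ^ 2 / (a₁ / t ^ β) ≤ a₁ * t ^ (-α - p) := by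
    have e : (a₁ / t ^ α) ^ 2 / (a₁ / t ^ β) = a₁ * (t ^ β / (t ^ α) ^ 2) := by
      have := (Real.rpow_pos_of_pos ht α).ne'
      have := (Real.rpow_pos_of_pos ht β).ne'
      field_simp
    rw [e, ← Real.rpow_mul_natCast ht.le, ← Real.rpow_sub ht]
    refine mul_le_mul_of_nonneg_left (Real.rpow_le_rpow_of_exponent_le h4 ?_) ha₁.le
    push_cast
    linarith
  have b3 : (a₁ / t ^ β) ^ 2 * (σ k : ℝ) ^ 2 ≤ a₁ ^ 2 * c ^ 2 * t ^ (-α - p) := by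
    calc (a₁ / t ^ β) ^ 2 * (σ k : ℝ) ^ 2 ≤ (a₁ / t ^ β) ^ 2 * (c * t ^ η) ^ 2 := by
          have := (σ k).coe_nonneg
          gcongr
      _ = a₁ ^ 2 * c ^ 2 * t ^ (-β * (2 : ℕ) + η * (2 : ℕ)) := by
          rw [eβ, Real.rpow_add ht, Real.rpow_mul_natCast ht.le, Real.rpow_mul_natCast ht.le]
          ring
      _ ≤ _ := by
          refine mul_le_mul_of_nonneg_left (Real.rpow_le_rpow_of_exponent_le h4 ?_) (by positivity)
          push_cast
          linarith
  have b4 : 1 - 2 * μ * (a₁ / t ^ α) + c₁ * (a₁ / t ^ α) ^ 2 ≤ 1 - a₁ * μ * t ^ (-α) := by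
    rw [eα]
    have := mul_le_mul_of_nonneg_right h3 (mul_nonneg ha₁.le hq)
    linarith
  calc u (k + 1) ≤ _ := h1
    _ ≤ (1 - a₁ * μ * t ^ (-α)) * u k + (c₂ * (a₁ ^ 2 * t ^ (-α - p)) + c₃ * (a₁ * t ^ (-α - p))
        + c₄ * (a₁ ^ 2 * c ^ 2 * t ^ (-α - p))) := by
      have := hu k
      gcongr
    _ = _ := by ring

end DPOpt

theorem theorem4 {V : Type*} [Fintype V] {d : ℕ}
    {Ξ : V → Type*} [∀ i, MeasurableSpace (Ξ i)]
    {Ω : Type*} [MeasurableSpace Ω] (P : Measure Ω) [IsProbabilityMeasure P]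
    (D : ∀ i, Measure (Ξ i)) [∀ i, IsProbabilityMeasure (D i)]
    (ℓ : ∀ i, EuclideanSpace ℝ (Fin d) → Ξ i → ℝ)
    (hℓ : ∀ i x, Integrable (ℓ i x) (D i))
    (μ : ℝ) (hf : DPOpt.RegularCosts (DPOpt.localCost D ℓ) μ)
    (g : ∀ i, EuclideanSpace ℝ (Fin d) → Ξ i → EuclideanSpace ℝ (Fin d))
    (σg : ℝ) (hg : DPOpt.GradientOracle D (DPOpt.localCost D ℓ) g σg)
    (G : SimpleGraph V) (A : Matrix V V ℝ) (hA : DPOpt.NetworkWeights G A)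
    (a₁ a₂ a₃ α β γ η : ℝ) (ha₁ : 0 < a₁) (ha₂ : 0 < a₂) (ha₃ : 0 < a₃)
    (hβ : 0 < β) (hβα : β < α) (hα : α ≤ 1) (hγ : 0 ≤ γ)
    (hη : 0 ≤ η) (hηβ : η ≤ (3 * β - 2) / 2)
    (σ : ℕ → ℝ≥0)
    (hσ : (fun k : ℕ => (σ k : ℝ)) =O[atTop] fun k : ℕ => ((k : ℝ) + a₂) ^ η)
    (ν : V → ℕ → Ω → EuclideanSpace ℝ (Fin d)) (hν : DPOpt.PrivacyNoise P σ ν)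
    (ξ : ∀ i, ℕ → ℕ → Ω → Ξ i) (hξ : DPOpt.DataSamples P D ξ)
    (hνξ : DPOpt.NoiseIndepData P ν ξ)
    (x₀ : V → EuclideanSpace ℝ (Fin d))
    (x : ℕ → V → Ω → EuclideanSpace ℝ (Fin d))
    (hx : x = DPOpt.iterate A
      (fun k => a₁ / ((k : ℝ) + a₂) ^ α)
      (fun k => a₁ / ((k : ℝ) + a₂) ^ β)
      (fun k => ⌈a₃ * ((k : ℝ) + a₂) ^ γ⌉₊) g x₀ ν ξ) :
    ∃ xs : EuclideanSpace ℝ (Fin d),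
      (∀ y, y ≠ xs → ∑ i, DPOpt.localCost D ℓ i xs < ∑ i, DPOpt.localCost D ℓ i y) ∧
      ∀ i,
        (∀ k, Integrable (fun ω => ‖x k i ω - xs‖ ^ 2) P) ∧
        (α < 1 →
          (fun k : ℕ => ∫ ω, ‖x k i ω - xs‖ ^ 2 ∂P) =O[atTop]
            fun k : ℕ => 1 / ((k : ℝ) + a₂) ^ min (3 * β - 2 * α - 2 * η) (α - β)) ∧
        (α = 1 →
          (fun k : ℕ => ∫ ω, ‖x k i ω - xs‖ ^ 2 ∂P) =O[atTop]
            fun k : ℕ => Real.log k /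
              ((k : ℝ) + a₂) ^ min (a₁ * μ - 1 + β) (min (3 * β - 2 * η - 2) (1 - β))) := by
  have : Nonempty V := hA.connected.nonempty
  set f := DPOpt.localCost D ℓ
  obtain ⟨xs, hmin, hzero⟩ := hf.exists_minimizer
  obtain ⟨L, -, hL⟩ := hf.exists_lipschitz
  obtain ⟨K, hK, hKz⟩ := hA.exists_sum_inner_sq_le hzero
  have hsq : ∀ k i, Integrable (fun ω => ‖x k i ω - xs‖ ^ 2) P := fun k i => by
    have h : MemLp (fun ω => x k i ω - xs) 2 P := by
      rw [hx]
      exact (DPOpt.memLp_iterate hf hg hν hξ hνξ k i).sub (memLp_const xs)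
    exact (memLp_two_iff_integrable_sq_norm h.1).1 h
  have hnn : ∀ k i, 0 ≤ ∫ ω, ‖x k i ω - xs‖ ^ 2 ∂P := fun k i =>
    integral_nonneg fun ω => sq_nonneg _
  have hrate : ∀ p : ℝ, p ≤ α - β → p ≤ 2 * β - 2 * η - α → (α < 1 ∨ α = 1 ∧ p < a₁ * μ) →
      ∀ i, (fun k : ℕ => ∫ ω, ‖x k i ω - xs‖ ^ 2 ∂P) =O[atTop]
        fun k : ℕ => ((k : ℝ) + a₂) ^ (-p) := by
    intro p hp hpη hpα i
    have hsum : (fun k : ℕ => ∑ j, ∫ ω, ‖x k j ω - xs‖ ^ 2 ∂P) =O[atTop]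
        fun k : ℕ => ((k : ℝ) + a₂) ^ (-p) := by
      refine DPOpt.isBigO_of_polynomial_steps (c₁ := 4 * L ^ 2)
        (c₂ := 4 * (∑ j, ‖∇ (f j) xs‖ ^ 2) + Fintype.card V * (2 * σg ^ 2)) (c₃ := 2 * K)
        (c₄ := Fintype.card V * (4 * d)) (fun k => Finset.sum_nonneg fun j _ => hnn k j)
        hf.mu_pos ha₁ ha₂ hβ hβα (by positivity) (by positivity) (by positivity) hσ hp hpη hpα ?_
      have hlim : Tendsto (fun k : ℕ => a₁ / ((k : ℝ) + a₂) ^ β) atTop (nhds 0) :=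
        tendsto_const_nhds.div_atTop
          ((tendsto_rpow_atTop hβ).comp (DPOpt.tendsto_natCast_add_atTop a₂))
      filter_upwards [hlim.eventually (eventually_le_nhds (by norm_num : (0 : ℝ) < 1 / 4))]
        with k hk
      have ht : 0 < (k : ℝ) + a₂ := by positivity
      have h := DPOpt.sum_integral_norm_sq_succ_le (x₀ := x₀)
        (stepα := fun k => a₁ / ((k : ℝ) + a₂) ^ α) (stepβ := fun k => a₁ / ((k : ℝ) + a₂) ^ β)
        (N := fun k => ⌈a₃ * ((k : ℝ) + a₂) ^ γ⌉₊) (k := k) hf hg hA hν hξ hνξ hL hK hKz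
        (by positivity) (by positivity) hk (Nat.ceil_pos.2 (by positivity)).ne'
      rw [← hx] at h
      refine h.trans (le_of_eq ?_)
      ring
    refine (IsBigO.of_bound 1 (Eventually.of_forall fun k => ?_)).trans hsum
    rw [one_mul, Real.norm_of_nonneg (hnn k i),
      Real.norm_of_nonneg (Finset.sum_nonneg fun j _ => hnn k j)]
    exact Finset.single_le_sum (fun j _ => hnn k j) (Finset.mem_univ i)
  refine ⟨xs, hmin, fun i => ⟨fun k => hsq k i, fun hα1 => ?_, fun hα1 => ?_⟩⟩
  · have h := hrate (min (3 * β - 2 * α - 2 * η) (α - β)) (min_le_right _ _)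
      ((min_le_left _ _).trans (by linarith)) (Or.inl hα1) i
    refine h.congr_right fun k => ?_
    rw [Real.rpow_neg (by positivity), one_div]
  · have h := hrate (min (a₁ * μ - 1 + β) (min (3 * β - 2 * η - 2) (1 - β)))
      ((min_le_right _ _).trans ((min_le_right _ _).trans (by linarith)))
      ((min_le_right _ _).trans ((min_le_left _ _).trans (by linarith)))
      (Or.inr ⟨hα1, (min_le_left _ _).trans_lt (by linarith)⟩) i
    -- The logarithm is not needed: it is eventually at least `1`.
    refine h.trans (IsBigO.of_bound 1 ?_)
    filter_upwards [(Real.tendsto_log_atTop.comp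
      tendsto_natCast_atTop_atTop).eventually_ge_atTop (1 : ℝ)] with k hk
    have hk' : (1 : ℝ) ≤ Real.log k := hk
    have ht : 0 < (k : ℝ) + a₂ := by positivity
    rw [one_mul, Real.rpow_neg ht.le, Real.norm_of_nonneg (by positivity),
      Real.norm_of_nonneg (by positivity), ← one_div]
    gcongr
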